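/- Let $\mathbb F$ be a field of characteristic not $2$ or $3$ and let $\eta\in\mathbb F\setminus\{1,\tfrac12\}$. Algebras are commutative but not necessarily associative $\mathbb F$-algebras. For an element $a$ of an algebra $A$ put $A_\lambda(a)=\{u\in A: au=\lambda u\}$. A \emph{$\mathcal{PC}(\eta)$-axis} of $A$ is an idempotent $a\in A$ with $A=A_1(a)\oplus A_\eta(a)\oplus A_{1/2}(a)$ and $A_1(a)A_\lambda(a)\subseteq A_\lambda(a)$ for $\lambda\in\{1,\eta,\tfrac12\}$, $A_\eta(a)A_\eta(a)\subseteq A_1(a)$, $A_\eta(a)A_{1/2}(a)\subseteq A_{1/2}(a)$, $A_{1/2}(a)A_{1/2}(a)\subseteq A_1(a)\oplus A_\eta(a)$. It is \emph{primitive} if $A_1(a)$ is one-dimensional. A \emph{$\mathcal{PC}(\eta)$-axial algebra generated by three primitive axes} is an algebra generated by three (not necessarily distinct) primitive $\mathcal{PC}(\eta)$-axes. If $\eta=-1$, let $\alpha,\beta,\gamma,\psi\in\mathbb F$ be arbitrary; if $\eta\ne-1$, let $\alpha=\beta=\gamma=\psi=1$. Let $A(\alpha,\beta,\gamma,\psi)$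 be the $8$-dimensional space with basis $e_1,\dots,e_8$, denoted $a,\,b,\,c,\,ab,\,bc,\,ac,\,a(bc),\,b(ac)$ in this order, with the commutative bilinear product given on the basis by the following table. In all cases $a\cdot a=a$, $b\cdot b=b$, $c\cdot c=c$; the products $a\cdot b$, $b\cdot c$, $a\cdot c$, $a\cdot bc$, $b\cdot ac$ are the basis vectors $ab$, $bc$, $ac$, $a(bc)$, $b(ac)$. If $\eta=-1$: - $c\cdot ab=\beta a+\gamma b+\alpha c-a(bc)-b(ac)$ - $a\cdot ab = \alpha a+\frac{1}{2}b-\frac{1}{2}{ab}$ - $a\cdot ac = \gamma a+\frac{1}{2}c-\frac{1}{2}{ac}$ - $b\cdot ab = \alpha b+\frac{1}{2}a-\frac{1}{2}{ab}$ - $b\cdot bc = \beta b+\frac{1}{2}c-\frac{1}{2}{bc}$ - $c\cdot ac =\gamma c+\frac{1}{2}a-\frac{1}{2}{ac}$ - $c\cdot bc = \beta c+\frac{1}{2}b-\frac{1}{2}{bc}$ - $a\cdot(a(bc))=\psi a+\frac{1}{2}bc-\frac{1}{2}a(bc)$ - $b\cdot(b(ac))=\psi b+\frac{1}{2}ac-\frac{1}{2}b(ac)$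 - $b\cdot a(bc)=\frac{1}{4}( \beta a+(\gamma-2\psi)b-3\alpha c-2\beta ab+ 6\alpha bc-ac+2a(bc)+2b(ac))$ - $c\cdot a(bc)=\frac{1}{4}(3\beta a-\gamma b+(3\alpha-2\psi)c-ab+6\gamma bc-2\beta ac-2b(ac))$ - $a\cdot b(ac)=\frac{1}{4}( (\beta-2\psi)a+\gamma b-3\alpha c-2\gamma ab -bc+6\alpha ac+2a(bc)+2b(ac) )$ - $c\cdot b(ac)=\frac{1}{4}(-\beta a+3\gamma b+(3\alpha-2\psi)c-ab-2\gamma bc+6\beta ac-2a(bc))$ - $(ab)^2=\frac{1}{4}((6\alpha-1)(a+b)-(4\alpha+2)ab)$ - $(bc)^2=\frac{1}{4}((6\beta-1)(b+c)-(4\beta+2)bc)$ - $(ac)^2=\frac{1}{4}((6\gamma-1)(a+c)-(4\gamma+2)ac)$ - $ab\cdot bc=\frac{1}{4}(3\beta a+(6\psi-\gamma)b+3\alpha c-2\beta ab-2\alpha bc-ac-2b(ac))$ - $bc\cdot ac=\frac{1}{4}(\beta a+\gamma b+(6\psi-3\alpha)c-ab-2\gamma bc-2\beta ac + 2a(bc)+2b(ac))$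 - $ab\cdot ac=\frac{1}{4}( (6\psi-\beta)a+3\gamma b+3\alpha c-2\gamma ab -bc-2\alpha ac-2a(bc) )$ - $ab\cdot a(bc)=\frac{1}{8}((12\alpha\beta-2\beta+6\gamma-6\psi)a+(6\psi-2\beta)b-c-4(\beta+\psi)ab +(6\alpha+1)bc-2ac+(2-4\alpha)a(bc))$ - $ab\cdot b(ac)=\frac{1}{8}((6\psi-2\gamma)a+(12\alpha\gamma+6\beta-2\gamma-6\psi)b-c-4(\gamma+\psi)ab-2bc +(6\alpha+1)ac+(2-4\alpha)b(ac))$ - $bc\cdot a(bc)=\frac{1}{8}( (4\beta^2-2\beta+2)a+(1-6\beta)ab+8\psi bc +(1-6\beta)ac+(4\beta+2)a(bc) )$ - $bc\cdot b(ac)=\frac{1}{8}(-a+(12\beta\gamma+6\alpha-2\gamma-6\psi)b+ (6\psi-2\gamma)c-2ab-4(\gamma+\psi)bc +(6\beta+1)ac+(2-4\beta)b(ac))$ - $ac\cdot a(bc)=\frac{1}{8}( (12\beta\gamma+6\alpha-2\beta-6\psi)a-b+(6\psi-2\beta)c-2ab +(6\gamma+1)bc-4(\beta+\psi)ac+(2-4\gamma)a(bc))$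 - $ac\cdot b(ac)=\frac{1}{8}( (4\gamma^2-2\gamma+2)b+(1-6\gamma)ab+ (1-6\gamma)bc +8\psi ac +(4\gamma+2)b(ac) )$ - $(a(bc))^2=\frac{1}{16}( (36\alpha\beta-4\beta^2+36\beta\gamma-24\beta\psi-6\alpha+2\beta-6\gamma-12\psi-2)a+(1-6\beta)(b+c) +2(1-6\beta)(ab+ac)+(4\beta+24\psi+2)bc+(8\beta-16\psi+4)a(bc) )$ - $(b(ac))^2=\frac{1}{16}( (1-6\gamma)(a+c)+(36\alpha\gamma+36\beta\gamma-4\gamma^2-24\gamma\psi-6\alpha-6\beta+2\gamma-12\psi-2)b +(2-12\gamma)(ab+bc)+(4\gamma+24\psi+2)ac+(8\gamma-16\psi+4)b(ac))$ - $a(bc)\cdot b(ac)=\frac{1}{16}( (12\beta\psi-6\alpha\beta-2\beta^2-14\beta\gamma+\beta+6\gamma+6\psi+1)a +(12\gamma\psi-6\alpha\gamma-14\beta\gamma-2\gamma^2+6\beta+\gamma+6\psi+1)b +(18\alpha^2+6\alpha\beta+6\alpha\gamma-36\alpha\psi+3\alpha-6\psi-2)c +(6\gamma-6\alpha+6\beta-32\beta\gamma+12\psi-1)ab+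 (24\alpha\gamma-6\alpha+2\beta+6\gamma-12\psi-1)bc +(24\alpha\beta-6\alpha+6\beta+2\gamma-12\psi-1)ac +(8\gamma-12\alpha-4\beta+16\psi-4)a(bc) +(8\beta-12\alpha-4\gamma+16\psi-4)b(ac))$ If $\eta\neq-1$: - $c\cdot ab=(\eta+1)(ab+bc+ac)-\eta(a+b+c)-a(bc)-b(ac)$ - $a\cdot ab = \frac{1}{2}((1-\eta)a-\eta b + (1+2\eta)ab)$ - $a\cdot ac = \frac{1}{2}((1-\eta)a-\eta c + (1+2\eta)ac)$ - $b\cdot ab = \frac{1}{2}((1-\eta)b-\eta a + (1+2\eta)ab)$ - $b\cdot bc = \frac{1}{2}((1-\eta)b-\eta c + (1+2\eta)bc)$ - $c\cdot ac = \frac{1}{2}((1-\eta)c-\eta a + (1+2\eta)ac)$ - $c\cdot bc = \frac{1}{2}((1-\eta)c-\eta b + (1+2\eta)bc)$ - $a\cdot a(bc)=\frac{1}{2}((1-\eta)a-\eta bc + (1+2\eta)a(bc))$ - $b\cdot b(ac)=\frac{1}{2}((1-\eta)b-\eta ac + (1+2\eta)b(ac))$ - $b\cdot a(bc)=\frac{1}{4}(-\eta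 a+ (1-2\eta^2)b+ (\eta-2\eta^2)c+2\eta ab+ (4\eta^2-2\eta)bc-ac+2a(bc)+2b(ac))$ - $c\cdot a(bc)=\frac{1}{4}(-3\eta a-(2\eta^2+2\eta-1)c+ (2\eta+1)(ab+2ac-\eta b)+(4\eta^2+2)bc-2b(ac) )$ - $a\cdot b(ac)=\frac{1}{4}( (1-2\eta^2)a-\eta b+(\eta-2\eta^2)c+2\eta ab -bc +(4\eta^2-2\eta)ac+2a(bc)+2b(ac))$ - $c\cdot b(ac)=\frac{1}{4}(-3\eta b-(2\eta^2+2\eta-1)c+ (2\eta+1)(ab+2bc-\eta a)+(4\eta^2+2)ac-2a(bc) )$ - $(ab)^2=\frac{1}{4}((1-4\eta)(a+b)+(8\eta+2)ab)$ - $(bc)^2=\frac{1}{4}((1-4\eta)(b+c)+(8\eta+2)bc)$ - $(ac)^2=\frac{1}{4}((1-4\eta)(a+c)+(8\eta+2)ac)$ - $ab\cdot bc=\frac{1}{4}( -3\eta(a+c)+(1-4\eta)b+(2\eta+1)(2ab+2bc+ac)-2b(ac))$ - $ab\cdot ac=\frac{1}{4}((1-4\eta)a-3\eta(b+c)+(2\eta+1)(2ab+bc+2ac)-2a(bc))$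 - $bc\cdot ac=\frac{1}{4}(-\eta(a+b)+(1-2\eta)c-ab+2\eta(bc+ac)+ 2a(bc)+2b(ac))$ - $ab\cdot a(bc)=\frac{1}{8}( (2-8\eta)a-(2\eta^2+5\eta-1)b-(2\eta^2+\eta)c+ (10\eta+2)ab +(4\eta^2-2\eta+1)bc+2\eta ac+(4\eta+2)a(bc))$ - $bc\cdot a(bc)=\frac{1}{8}(-4\eta a-(4\eta^2+3\eta-1)(b+c)+(4\eta-1)(ab+ac) +(8\eta^2+2\eta+2)bc+6a(bc))$ - $ac\cdot a(bc)=\frac{1}{8}( (2-8\eta)a-(2\eta^2+\eta)b-(2\eta^2+5\eta-1)c + 2\eta ab +(4\eta^2-2\eta+1)bc+(10\eta+2)ac+(4\eta+2)a(bc))$ - $ab\cdot b(ac)=\frac{1}{8}((1-5\eta-2\eta^2)a+(2-8\eta)b-(2\eta^2+\eta)c+ (10\eta+2)ab +2\eta bc+(4\eta^2-2\eta+1)ac+(4\eta+2)b(ac))$ - $bc\cdot b(ac)=\frac{1}{8}(-(2\eta^2+\eta)a+(2-8\eta)b+(1-5\eta-2\eta^2)c+2\eta ab +(10\eta+2)bc+(4\eta^2-2\eta+1)ac+(4\eta+2)b(ac))$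 - $ac\cdot b(ac)=\frac{1}{8}((1-3\eta-4\eta^2)(a+c)-4\eta b+ (4\eta-1)(ab+bc) +(8\eta^2+2\eta+2)ac+6b(ac))$ - $(a(bc))^2=\frac{1}{16}( (4-16\eta)a+(1-2\eta-8\eta^2)(b+c)+(8\eta-2)(ab+ac+(2\eta-1)bc) +(16\eta+12)a(bc) )$ - $(b(ac))^2=\frac{1}{16}( (1-2\eta-8\eta^2)(a+c)+(4-16\eta)b+ (8\eta-2)(ab+bc+(2\eta-1)ac) +(16\eta+12)b(ac) )$ - $a(bc)\cdot b(ac)=\frac{1}{16}( (2-8\eta-6\eta^2)(a+b)+(1-12\eta^2)c + (12\eta-3)ab +(12\eta^2-2\eta-1)(bc+ac)+(4\eta+8)(a(bc)+b(ac)) )$ Then: 1. $A(\alpha,\beta,\gamma,\psi)$ is a $\mathcal{PC}(\eta)$-axial algebra generated by the three primitive axes $e_1,e_2,e_3$. 2. Let $A$ be any $\mathcal{PC}(\eta)$-axial algebra generated by three primitive axes $x,y,z$. Then $A$ has a unique Frobenius form, that is, a non-zero symmetric bilinear form with $(uv,w)=(u,vw)$ for all $u,v,w\in A$, such that $(d,d)=1$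 for every primitive $\mathcal{PC}(\eta)$-axis $d$ of $A$. If for this form $(x,y)=\alpha$, $(y,z)=\beta$, $(x,z)=\gamma$ and $(x,yz)=\psi$, then $A$ is a homomorphic image of $A(\alpha,\beta,\gamma,\psi)$. -/

import Mathlib

/-! ### Fusion laws and axial algebras -/

/-- A fusion law over `F`: a subset `carrier` of `F` and a map assigning to each pair of its
elements a subset of `carrier`. -/
structure FusionLaw (F : Type*) where
  carrier : Set F
  op : F → F → Set F
  op_subset : ∀ r ∈ carrier, ∀ s ∈ carrier, op r s ⊆ carrier

open Classical in
/-- The fusion law `PC(η)` on `{1, η, 1/2}` (used for `η ≠ 1, 1/2` and characteristic not two):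
`1` is a unit, `η ∗ η = {1}`, `η ∗ 1/2 = {1/2}` and `1/2 ∗ 1/2 = {η, 1}`. -/
noncomputable def pcLaw {F : Type*} [Field F] (η : F) : FusionLaw F where
  carrier := {1, η, 1 / 2}
  op r s :=
    if r = 1 then {s}
    else if s = 1 then {r}
    else if r = η ∧ s = η then {1}
    else if r = η ∨ s = η then {1 / 2}
    else {η, 1}
  op_subset := by
    intro r hr s hs t ht
    simp only [Set.mem_insert_iff, Set.mem_singleton_iff] at hr hs ⊢
    split_ifs at ht <;> simp only [Set.mem_insert_iff, Set.mem_singleton_iff] at ht <;>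
      subst_vars <;> tauto

section Axial

variable (F : Type*) {A : Type*} [Field F] [NonUnitalNonAssocCommRing A] [Module F A]
  [IsScalarTower F A A] [SMulCommClass F A A]

/-- The eigenspace `A_r(a) = {u | a * u = r • u}`. -/
def adEigenspace (a : A) (r : F) : Submodule F A where
  carrier := {u | a * u = r • u}
  add_mem' := by
    intro u v hu hv
    simp only [Set.mem_ofPred_eq] at hu hv ⊢
    rw [mul_add, hu, hv, smul_add]
  zero_mem' := by simp
  smul_mem' := by
    intro c u hu
    simp only [Set.mem_ofPred_eq] at hu ⊢
    rw [mul_smul_comm, hu, smul_comm]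

/-- `A_L(a)`, the sum of the eigenspaces `A_r(a)` for `r ∈ L`. The sum is automatically direct. -/
def adEigenspaces (a : A) (L : Set F) : Submodule F A :=
  ⨆ r ∈ L, adEigenspace F a r

variable {F}

/-- `a` is an axis for the fusion law `L`: an idempotent such that `A` is the sum of the
eigenspaces `A_r(a)`, `r ∈ L`, and these multiply according to `L`. -/
structure IsAxis (L : FusionLaw F) (a : A) : Prop where
  idem : a * a = a
  decomp : adEigenspaces F a L.carrier = ⊤
  fusion : ∀ r ∈ L.carrier, ∀ s ∈ L.carrier, ∀ u ∈ adEigenspace F a r, ∀ v ∈ adEigenspace F a s,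
    u * v ∈ adEigenspaces F a (L.op r s)

/-- A primitive axis: `A_1(a)` is one-dimensional (and hence spanned by `a`). -/
structure IsPrimitiveAxis (L : FusionLaw F) (a : A) : Prop extends IsAxis L a where
  ne_zero : a ≠ 0
  primitive : adEigenspace F a 1 = Submodule.span F {a}

/-- `A` is an axial algebra with fusion law `L`, generated by the set `X` of primitive axes. -/
structure IsPrimitiveAxialAlgebra (L : FusionLaw F) (X : Set A) : Prop where
  axis : ∀ a ∈ X, IsPrimitiveAxis L a
  generates : NonUnitalAlgebra.adjoin F X = ⊤

/-- A Frobenius form (non-zero, symmetric, bilinear, associating with the product) with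
`(a, a) = 1` for every primitive axis `a` of `A`. -/
structure IsNormalizedFrobeniusForm (L : FusionLaw F) (B : LinearMap.BilinForm F A) : Prop where
  ne_zero : B ≠ 0
  symm : ∀ u v, B u v = B v u
  assoc : ∀ u v w, B (u * v) w = B u (v * w)
  normalized : ∀ a : A, IsPrimitiveAxis L a → B a a = 1

end Axial

/-! ### The tables of products -/

section Tables

variable {F M : Type*} [Field F] [AddCommGroup M] [Module F M]

/-- The products of `a, b, c, ab, bc, ac, a(bc), b(ac)` (indexed by `0, …, 7` in this order) for
`η = -1`. The vectors `abc` and `bac` stand for `a(bc)` and `b(ac)`. Only the entries on and above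
the diagonal are meaningful. -/
def upperTableNegOne (α β γ ψ : F) (a b c ab bc ac abc bac : M) : Fin 8 → Fin 8 → M :=
  ![
  -- products with `a`
  ![a,
    ab,
    ac,
    α • a + (1/2 : F) • b - (1/2 : F) • ab,
    abc,
    γ • a + (1/2 : F) • c - (1/2 : F) • ac,
    ψ • a + (1/2 : F) • bc - (1/2 : F) • abc,
    (1/4 : F) • ((β - 2*ψ) • a + γ • b - (3*α) • c - (2*γ) • ab - bc + (6*α) • ac
      + (2 : F) • abc + (2 : F) • bac)],
  -- products with `b`
  ![0,
    b,
    bc,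
    α • b + (1/2 : F) • a - (1/2 : F) • ab,
    β • b + (1/2 : F) • c - (1/2 : F) • bc,
    bac,
    (1/4 : F) • (β • a + (γ - 2*ψ) • b - (3*α) • c - (2*β) • ab + (6*α) • bc - ac
      + (2 : F) • abc + (2 : F) • bac),
    ψ • b + (1/2 : F) • ac - (1/2 : F) • bac],
  -- products with `c`
  ![0, 0,
    c,
    β • a + γ • b + α • c - abc - bac,
    β • c + (1/2 : F) • b - (1/2 : F) • bc,
    γ • c + (1/2 : F) • a - (1/2 : F) • ac,
    (1/4 : F) • ((3*β) • a - γ • b + (3*α - 2*ψ) • c - ab + (6*γ) • bc - (2*β) • ac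
      - (2 : F) • bac),
    (1/4 : F) • ((-β) • a + (3*γ) • b + (3*α - 2*ψ) • c - ab - (2*γ) • bc + (6*β) • ac
      - (2 : F) • abc)],
  -- products with `ab`
  ![0, 0, 0,
    (1/4 : F) • ((6*α - 1) • (a + b) - (4*α + 2) • ab),
    (1/4 : F) • ((3*β) • a + (6*ψ - γ) • b + (3*α) • c - (2*β) • ab - (2*α) • bc - ac
      - (2 : F) • bac),
    (1/4 : F) • ((6*ψ - β) • a + (3*γ) • b + (3*α) • c - (2*γ) • ab - bc - (2*α) • ac
      - (2 : F) • abc),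
    (1/8 : F) • ((12*α*β - 2*β + 6*γ - 6*ψ) • a + (6*ψ - 2*β) • b - c - (4*(β + ψ)) • ab
      + (6*α + 1) • bc - (2 : F) • ac + (2 - 4*α) • abc),
    (1/8 : F) • ((6*ψ - 2*γ) • a + (12*α*γ + 6*β - 2*γ - 6*ψ) • b - c - (4*(γ + ψ)) • ab
      - (2 : F) • bc + (6*α + 1) • ac + (2 - 4*α) • bac)],
  -- products with `bc`
  ![0, 0, 0, 0,
    (1/4 : F) • ((6*β - 1) • (b + c) - (4*β + 2) • bc),
    (1/4 : F) • (β • a + γ • b + (6*ψ - 3*α) • c - ab - (2*γ) • bc - (2*β) • ac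
      + (2 : F) • abc + (2 : F) • bac),
    (1/8 : F) • ((4*β^2 - 2*β + 2) • a + (1 - 6*β) • ab + (8*ψ) • bc + (1 - 6*β) • ac
      + (4*β + 2) • abc),
    (1/8 : F) • (-a + (12*β*γ + 6*α - 2*γ - 6*ψ) • b + (6*ψ - 2*γ) • c - (2 : F) • ab
      - (4*(γ + ψ)) • bc + (6*β + 1) • ac + (2 - 4*β) • bac)],
  -- products with `ac`
  ![0, 0, 0, 0, 0,
    (1/4 : F) • ((6*γ - 1) • (a + c) - (4*γ + 2) • ac),
    (1/8 : F) • ((12*β*γ + 6*α - 2*β - 6*ψ) • a - b + (6*ψ - 2*β) • c - (2 : F) • ab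
      + (6*γ + 1) • bc - (4*(β + ψ)) • ac + (2 - 4*γ) • abc),
    (1/8 : F) • ((4*γ^2 - 2*γ + 2) • b + (1 - 6*γ) • ab + (1 - 6*γ) • bc + (8*ψ) • ac
      + (4*γ + 2) • bac)],
  -- products with `a(bc)`
  ![0, 0, 0, 0, 0, 0,
    (1/16 : F) • ((36*α*β - 4*β^2 + 36*β*γ - 24*β*ψ - 6*α + 2*β - 6*γ - 12*ψ - 2) • a
      + (1 - 6*β) • (b + c) + (2*(1 - 6*β)) • (ab + ac) + (4*β + 24*ψ + 2) • bc
      + (8*β - 16*ψ + 4) • abc),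
    (1/16 : F) • ((12*β*ψ - 6*α*β - 2*β^2 - 14*β*γ + β + 6*γ + 6*ψ + 1) • a
      + (12*γ*ψ - 6*α*γ - 14*β*γ - 2*γ^2 + 6*β + γ + 6*ψ + 1) • b
      + (18*α^2 + 6*α*β + 6*α*γ - 36*α*ψ + 3*α - 6*ψ - 2) • c
      + (6*γ - 6*α + 6*β - 32*β*γ + 12*ψ - 1) • ab
      + (24*α*γ - 6*α + 2*β + 6*γ - 12*ψ - 1) • bc
      + (24*α*β - 6*α + 6*β + 2*γ - 12*ψ - 1) • ac
      + (8*γ - 12*α - 4*β + 16*ψ - 4) • abc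
      + (8*β - 12*α - 4*γ + 16*ψ - 4) • bac)],
  -- product of `b(ac)` with itself
  ![0, 0, 0, 0, 0, 0, 0,
    (1/16 : F) • ((1 - 6*γ) • (a + c)
      + (36*α*γ + 36*β*γ - 4*γ^2 - 24*γ*ψ - 6*α - 6*β + 2*γ - 12*ψ - 2) • b
      + (2 - 12*γ) • (ab + bc) + (4*γ + 24*ψ + 2) • ac + (8*γ - 16*ψ + 4) • bac)]]

/-- The products of `a, b, c, ab, bc, ac, a(bc), b(ac)` (indexed by `0, …, 7` in this order) for
`η ≠ -1`. The vectors `abc` and `bac` stand for `a(bc)` and `b(ac)`. Only the entries on and above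
the diagonal are meaningful. -/
def upperTableGeneric (η : F) (a b c ab bc ac abc bac : M) : Fin 8 → Fin 8 → M :=
  ![
  -- products with `a`
  ![a,
    ab,
    ac,
    (1/2 : F) • ((1 - η) • a - η • b + (1 + 2*η) • ab),
    abc,
    (1/2 : F) • ((1 - η) • a - η • c + (1 + 2*η) • ac),
    (1/2 : F) • ((1 - η) • a - η • bc + (1 + 2*η) • abc),
    (1/4 : F) • ((1 - 2*η^2) • a - η • b + (η - 2*η^2) • c + (2*η) • ab - bc
      + (4*η^2 - 2*η) • ac + (2 : F) • abc + (2 : F) • bac)],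
  -- products with `b`
  ![0,
    b,
    bc,
    (1/2 : F) • ((1 - η) • b - η • a + (1 + 2*η) • ab),
    (1/2 : F) • ((1 - η) • b - η • c + (1 + 2*η) • bc),
    bac,
    (1/4 : F) • ((-η) • a + (1 - 2*η^2) • b + (η - 2*η^2) • c + (2*η) • ab
      + (4*η^2 - 2*η) • bc - ac + (2 : F) • abc + (2 : F) • bac),
    (1/2 : F) • ((1 - η) • b - η • ac + (1 + 2*η) • bac)],
  -- products with `c`
  ![0, 0,
    c,
    (η + 1) • (ab + bc + ac) - η • (a + b + c) - abc - bac,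
    (1/2 : F) • ((1 - η) • c - η • b + (1 + 2*η) • bc),
    (1/2 : F) • ((1 - η) • c - η • a + (1 + 2*η) • ac),
    (1/4 : F) • ((-3*η) • a - (2*η^2 + 2*η - 1) • c + (2*η + 1) • (ab + (2 : F) • ac - η • b)
      + (4*η^2 + 2) • bc - (2 : F) • bac),
    (1/4 : F) • ((-3*η) • b - (2*η^2 + 2*η - 1) • c + (2*η + 1) • (ab + (2 : F) • bc - η • a)
      + (4*η^2 + 2) • ac - (2 : F) • abc)],
  -- products with `ab`
  ![0, 0, 0,
    (1/4 : F) • ((1 - 4*η) • (a + b) + (8*η + 2) • ab),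
    (1/4 : F) • ((-3*η) • (a + c) + (1 - 4*η) • b
      + (2*η + 1) • ((2 : F) • ab + (2 : F) • bc + ac) - (2 : F) • bac),
    (1/4 : F) • ((1 - 4*η) • a - (3*η) • (b + c)
      + (2*η + 1) • ((2 : F) • ab + bc + (2 : F) • ac) - (2 : F) • abc),
    (1/8 : F) • ((2 - 8*η) • a - (2*η^2 + 5*η - 1) • b - (2*η^2 + η) • c + (10*η + 2) • ab
      + (4*η^2 - 2*η + 1) • bc + (2*η) • ac + (4*η + 2) • abc),
    (1/8 : F) • ((1 - 5*η - 2*η^2) • a + (2 - 8*η) • b - (2*η^2 + η) • c + (10*η + 2) • ab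
      + (2*η) • bc + (4*η^2 - 2*η + 1) • ac + (4*η + 2) • bac)],
  -- products with `bc`
  ![0, 0, 0, 0,
    (1/4 : F) • ((1 - 4*η) • (b + c) + (8*η + 2) • bc),
    (1/4 : F) • ((-η) • (a + b) + (1 - 2*η) • c - ab + (2*η) • (bc + ac) + (2 : F) • abc
      + (2 : F) • bac),
    (1/8 : F) • ((-4*η) • a - (4*η^2 + 3*η - 1) • (b + c) + (4*η - 1) • (ab + ac)
      + (8*η^2 + 2*η + 2) • bc + (6 : F) • abc),
    (1/8 : F) • (-((2*η^2 + η) • a) + (2 - 8*η) • b + (1 - 5*η - 2*η^2) • c + (2*η) • ab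
      + (10*η + 2) • bc + (4*η^2 - 2*η + 1) • ac + (4*η + 2) • bac)],
  -- products with `ac`
  ![0, 0, 0, 0, 0,
    (1/4 : F) • ((1 - 4*η) • (a + c) + (8*η + 2) • ac),
    (1/8 : F) • ((2 - 8*η) • a - (2*η^2 + η) • b - (2*η^2 + 5*η - 1) • c + (2*η) • ab
      + (4*η^2 - 2*η + 1) • bc + (10*η + 2) • ac + (4*η + 2) • abc),
    (1/8 : F) • ((1 - 3*η - 4*η^2) • (a + c) - (4*η) • b + (4*η - 1) • (ab + bc)
      + (8*η^2 + 2*η + 2) • ac + (6 : F) • bac)],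
  -- products with `a(bc)`
  ![0, 0, 0, 0, 0, 0,
    (1/16 : F) • ((4 - 16*η) • a + (1 - 2*η - 8*η^2) • (b + c)
      + (8*η - 2) • (ab + ac + (2*η - 1) • bc) + (16*η + 12) • abc),
    (1/16 : F) • ((2 - 8*η - 6*η^2) • (a + b) + (1 - 12*η^2) • c + (12*η - 3) • ab
      + (12*η^2 - 2*η - 1) • (bc + ac) + (4*η + 8) • (abc + bac))],
  -- product of `b(ac)` with itself
  ![0, 0, 0, 0, 0, 0, 0,
    (1/16 : F) • ((1 - 2*η - 8*η^2) • (a + c) + (4 - 16*η) • b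
      + (8*η - 2) • (ab + bc + (2*η - 1) • ac) + (16*η + 12) • bac)]]

end Tables

/-! ### The algebra `A(α, β, γ, ψ)` -/

section PCAlgebra

variable {F : Type*} [Field F]

/-- The underlying space of `A(α, β, γ, ψ)` for the fusion law `PC(η)`: the coordinate space of
dimension 8, with the standard basis `e₁, …, e₈`. -/
def PCAlgebra {F : Type*} [Field F] (_η _α _β _γ _ψ : F) : Type _ := Fin 8 → F

namespace PCAlgebra

variable (η α β γ ψ : F)

noncomputable instance : AddCommGroup (PCAlgebra η α β γ ψ) :=
  inferInstanceAs (AddCommGroup (Fin 8 → F))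

noncomputable instance : Module F (PCAlgebra η α β γ ψ) :=
  inferInstanceAs (Module F (Fin 8 → F))

/-- The basis vector `e_{i+1}`. In terms of the tables, `basisVec 0, …, basisVec 7` are
`a, b, c, ab, bc, ac, a(bc), b(ac)`. -/
def basisVec (i : Fin 8) : PCAlgebra η α β γ ψ := (Pi.single i 1 : Fin 8 → F)

open Classical in
/-- The upper triangular part of the table of products of the basis vectors. -/
noncomputable def upperTable : Fin 8 → Fin 8 → PCAlgebra η α β γ ψ :=
  let e := basisVec η α β γ ψ
  if η = -1 then upperTableNegOne α β γ ψ (e 0) (e 1) (e 2) (e 3) (e 4) (e 5) (e 6) (e 7)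
  else upperTableGeneric η (e 0) (e 1) (e 2) (e 3) (e 4) (e 5) (e 6) (e 7)

/-- The product of the basis vectors with indices `i` and `j`; the table is symmetric. -/
noncomputable def table (i j : Fin 8) : PCAlgebra η α β γ ψ :=
  upperTable η α β γ ψ (min i j) (max i j)

variable {η α β γ ψ}

/-- The `i`-th coordinate of a vector. -/
def coord (u : PCAlgebra η α β γ ψ) (i : Fin 8) : F := (show Fin 8 → F from u) i

theorem coord_add (u v : PCAlgebra η α β γ ψ) (i : Fin 8) :
    coord (u + v) i = coord u i + coord v i := rfl

theorem coord_smul (r : F) (u : PCAlgebra η α β γ ψ) (i : Fin 8) :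
    coord (r • u) i = r * coord u i := rfl

theorem coord_zero (i : Fin 8) : coord (0 : PCAlgebra η α β γ ψ) i = 0 := rfl

/-- The product extends the table of products of the basis vectors bilinearly. -/
noncomputable instance : Mul (PCAlgebra η α β γ ψ) :=
  ⟨fun u v => ∑ i, ∑ j, (coord u i * coord v j) • table η α β γ ψ i j⟩

theorem mul_def (u v : PCAlgebra η α β γ ψ) :
    u * v = ∑ i, ∑ j, (coord u i * coord v j) • table η α β γ ψ i j := rfl

noncomputable instance : NonUnitalNonAssocCommRing (PCAlgebra η α β γ ψ) where
  left_distrib u v w := by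
    simp only [mul_def, coord_add, mul_add, add_smul, Finset.sum_add_distrib]
  right_distrib u v w := by
    simp only [mul_def, coord_add, add_mul, add_smul, Finset.sum_add_distrib]
  zero_mul u := by simp [mul_def, coord_zero]
  mul_zero u := by simp [mul_def, coord_zero]
  mul_comm u v := by
    rw [mul_def, mul_def, Finset.sum_comm]
    refine Finset.sum_congr rfl fun i _ => Finset.sum_congr rfl fun j _ => ?_
    rw [mul_comm (coord u j), table, table, min_comm, max_comm]

instance : IsScalarTower F (PCAlgebra η α β γ ψ) (PCAlgebra η α β γ ψ) where
  smul_assoc r u v := by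
    simp only [smul_eq_mul, mul_def, coord_smul, Finset.smul_sum, smul_smul, mul_assoc]

instance : SMulCommClass F (PCAlgebra η α β γ ψ) (PCAlgebra η α β γ ψ) where
  smul_comm r u v := by
    simp only [smul_eq_mul, mul_def, coord_smul, Finset.smul_sum, smul_smul, mul_left_comm]

end PCAlgebra

end PCAlgebra

set_option linter.unusedSectionVars false

/-! ### Primitive axes in terms of Peirce components -/

section PeirceAxis

variable {F A : Type*} [Field F] [NonUnitalNonAssocCommRing A] [Module F A]
  [IsScalarTower F A A] [SMulCommClass F A A]

/-! Everything rests on two facts: the algebra has a form whose value at an axis `a` and a vector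
`u` is the coefficient of `u` along `a`, and this form enters a cubic identity that is almost
equivalent to the axis conditions.

The form. Expanding `b * b = b` with respect to `a`, together with the quadratic relation for `ad b`
on `a`, shows that the coefficient of `b` along `a` equals that of `a` along `b`, and equals `1`
when `η ≠ -1` (`IsPeirceAxis.coeff_symm`). The Miyamoto involutions map axes to axes, so an algebra
generated by axes is linearly spanned by them (`span_isPeirceAxis_eq_top`). Hence the coefficient
functions fit together into a symmetric form, which is associative because every `ad a` is
self-adjoint for it (`exists_frobenius_form`). Associativity and normalization determine it on axes,
hence everywhere (`frobenius_form_unique`).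

The cubic identity. In an algebra spanned by axes the polarization of `x³ = (1 + η) l(x) x² - η (x,
x) x` holds, where `l = (c, ·)` for any axis `c` (`cubicIdentity_of_span_axes`). For `η = -1` the
form `l` drops out; for `η ≠ -1` all axes have the same row and `(u, v) = l(u) l(v)`. Conversely, an
idempotent `a` satisfying the identity for all triples `a, y, z`, with a form for which `(a, a) = 1`
and `ad a` is self-adjoint, is an axis (`isPeirceAxis_of_cubicIdentity`).

The two parts of the theorem. For `A(α, β, γ, ψ)` the identity with one argument among the three
generators is a finite list of polynomial identities between structure constants; they are verified
by computation with integer polynomials, after rescaling the basis to clear denominators, and the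
converse above gives the axes. In any algebra generated by axes `x, y, z`, the identity and the
associativity of the form force all products of the eight vectors (`IsCubicTable.defects_eq_zero`,
`IsCubicTable.mul_eq`). So the linear map sending basis vectors to these vectors is a homomorphism,
and its image contains the generators. -/

/-- The conditions for a primitive axis of `PC(η)`, element by element. -/
structure IsPeirceAxis (η : F) (a : A) : Prop where
  idem : a * a = a
  ne_zero : a ≠ 0
  one_dim : ∀ u, a * u = u → ∃ p : F, u = p • a
  decomp : ∀ u, ∃ (p : F) (v w : A), u = p • a + v + w ∧ a * v = η • v ∧ a * w = (1 / 2 : F) • w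
  mul_eta_eta : ∀ u v, a * u = η • u → a * v = η • v → ∃ p : F, u * v = p • a
  mul_eta_half : ∀ u v, a * u = η • u → a * v = (1 / 2 : F) • v →
    a * (u * v) = (1 / 2 : F) • (u * v)
  mul_half_half : ∀ u v, a * u = (1 / 2 : F) • u → a * v = (1 / 2 : F) • v →
    ∃ (p : F) (r : A), u * v = p • a + r ∧ a * r = η • r

theorem mem_adEigenspace {a u : A} {r : F} : u ∈ adEigenspace F a r ↔ a * u = r • u := Iff.rfl

theorem adEigenspaces_singleton (a : A) (r : F) : adEigenspaces F a {r} = adEigenspace F a r := by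
  simp [adEigenspaces]

theorem adEigenspaces_pair (a : A) (r s : F) :
    adEigenspaces F a {r, s} = adEigenspace F a r ⊔ adEigenspace F a s := by
  rw [adEigenspaces, iSup_pair]

theorem adEigenspaces_triple (a : A) (r s t : F) :
    adEigenspaces F a {r, s, t} =
      adEigenspace F a r ⊔ (adEigenspace F a s ⊔ adEigenspace F a t) := by
  rw [adEigenspaces, iSup_insert, iSup_pair]

variable {η : F} {a : A}

theorem IsPrimitiveAxis.isPeirceAxis (h2 : (2 : F) ≠ 0) (hη1 : η ≠ 1) (hη2 : η ≠ 1 / 2)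
    (h : IsPrimitiveAxis (pcLaw η) a) : IsPeirceAxis η a := by
  have h12 : (1 / 2 : F) ≠ 1 := by
    intro e
    rw [div_eq_iff h2] at e
    have : (2 : F) - 1 = 0 := by linear_combination -e
    norm_num at this
  have m1 : (1 : F) ∈ (pcLaw η).carrier := Or.inl rfl
  have mη : η ∈ (pcLaw η).carrier := Or.inr (Or.inl rfl)
  have mh : (1 / 2 : F) ∈ (pcLaw η).carrier := Or.inr (Or.inr rfl)
  refine ⟨h.idem, h.ne_zero, fun u hu => ?_, fun u => ?_, fun u v hu hv => ?_,
    fun u v hu hv => ?_, fun u v hu hv => ?_⟩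
  · have : u ∈ adEigenspace F a 1 := by rw [mem_adEigenspace, hu, one_smul]
    rw [h.primitive, Submodule.mem_span_singleton] at this
    obtain ⟨p, hp⟩ := this
    exact ⟨p, hp.symm⟩
  · have : u ∈ adEigenspaces F a (pcLaw η).carrier := h.decomp ▸ Submodule.mem_top
    simp only [pcLaw, adEigenspaces_triple, h.primitive] at this
    obtain ⟨x, hx, y, hy, rfl⟩ := Submodule.mem_sup.1 this
    obtain ⟨p, rfl⟩ := Submodule.mem_span_singleton.1 hx
    obtain ⟨v, hv, w, hw, rfl⟩ := Submodule.mem_sup.1 hy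
    exact ⟨p, v, w, (add_assoc _ _ _).symm, hv, hw⟩
  · have := h.fusion η mη η mη u hu v hv
    simp only [pcLaw, hη1, if_false, and_self, if_true, adEigenspaces_singleton, h.primitive] at this
    obtain ⟨p, hp⟩ := Submodule.mem_span_singleton.1 this
    exact ⟨p, hp.symm⟩
  · have := h.fusion η mη _ mh u hu v hv
    simpa only [pcLaw, hη1, if_false, h12, hη2.symm, and_false, true_or, if_true,
      adEigenspaces_singleton, mem_adEigenspace] using this
  · have := h.fusion _ mh _ mh u hu v hv
    simp only [pcLaw, if_false, h12, hη2.symm, and_false, or_false,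
      adEigenspaces_pair, h.primitive] at this
    obtain ⟨r, hr, y, hy, e⟩ := Submodule.mem_sup.1 this
    obtain ⟨p, rfl⟩ := Submodule.mem_span_singleton.1 hy
    exact ⟨p, r, by rw [← e, add_comm], hr⟩

theorem IsPeirceAxis.isPrimitiveAxis (h2 : (2 : F) ≠ 0) (hη1 : η ≠ 1) (hη2 : η ≠ 1 / 2)
    (h : IsPeirceAxis η a) : IsPrimitiveAxis (pcLaw η) a := by
  have h12 : (1 / 2 : F) ≠ 1 := by
    intro e
    rw [div_eq_iff h2] at e
    have : (2 : F) - 1 = 0 := by linear_combination -e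
    norm_num at this
  have hprim : adEigenspace F a 1 = Submodule.span F {a} := by
    ext u
    rw [mem_adEigenspace, Submodule.mem_span_singleton, one_smul]
    refine ⟨fun hu => ?_, ?_⟩
    · obtain ⟨p, hp⟩ := h.one_dim u hu
      exact ⟨p, hp.symm⟩
    · rintro ⟨p, rfl⟩
      rw [mul_smul_comm, h.idem]
  -- Since `A_1(a)` is spanned by `a`, the products `A_1 A_r ⊆ A_r` are automatic; this is why
  -- `IsPeirceAxis` does not list them.
  have hcomm : ∀ r (u v : A), u ∈ adEigenspace F a 1 → v ∈ adEigenspace F a r →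
      u * v ∈ adEigenspace F a r := by
    intro r u v hu hv
    rw [hprim] at hu
    obtain ⟨p, rfl⟩ := Submodule.mem_span_singleton.1 hu
    rw [smul_mul_assoc, mem_adEigenspace.1 hv]
    exact Submodule.smul_mem _ _ (Submodule.smul_mem _ _ hv)
  refine ⟨⟨h.idem, ?_, ?_⟩, h.ne_zero, hprim⟩
  · rw [eq_top_iff]
    intro u _
    obtain ⟨p, v, w, rfl, hv, hw⟩ := h.decomp u
    simp only [pcLaw, adEigenspaces_triple, add_assoc]
    refine Submodule.add_mem_sup ?_ (Submodule.add_mem_sup hv hw)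
    rw [mem_adEigenspace, mul_smul_comm, h.idem, one_smul]
  · intro r hr s hs u hu v hv
    simp only [pcLaw]
    split_ifs with c1 c2 c3 c4
    · subst c1
      rw [adEigenspaces_singleton]
      exact hcomm s u v hu hv
    · subst c2
      rw [adEigenspaces_singleton, mul_comm]
      exact hcomm r v u hv hu
    · obtain ⟨rfl, rfl⟩ := c3
      rw [adEigenspaces_singleton, hprim, Submodule.mem_span_singleton]
      obtain ⟨p, hp⟩ := h.mul_eta_eta u v hu hv
      exact ⟨p, hp.symm⟩
    · simp only [pcLaw, Set.mem_insert_iff, Set.mem_singleton_iff, c1, c2, false_or] at hr hs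
      rw [adEigenspaces_singleton, mem_adEigenspace]
      rcases hr with rfl | rfl <;> rcases hs with rfl | rfl
      · exact absurd ⟨rfl, rfl⟩ c3
      · exact h.mul_eta_half u v hu hv
      · rw [mul_comm u v]
        exact h.mul_eta_half v u hv hu
      · exact absurd c4 (by simpa using hη2.symm)
    · simp only [pcLaw, Set.mem_insert_iff, Set.mem_singleton_iff, c1, c2, false_or] at hr hs
      rw [not_or] at c4
      obtain rfl := hr.resolve_left c4.1
      obtain rfl := hs.resolve_left c4.2
      obtain ⟨p, r, e, hr⟩ := h.mul_half_half u v hu hv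
      rw [adEigenspaces_pair, e, add_comm, hprim]
      exact Submodule.add_mem_sup hr (Submodule.smul_mem _ _ (Submodule.mem_span_singleton_self a))

/-- A Vandermonde elimination: applying `ad a` and subtracting removes `w`, applying it again
removes `v`. Only idempotence is assumed, so that the statement can also be used for elements not
yet known to be axes. -/
theorem eq_zero_of_peirce_sum_eq_zero (idem : a * a = a) (ne_zero : a ≠ 0) (h2 : (2 : F) ≠ 0) (hη1 : η ≠ 1)
    (hη2 : η ≠ 1 / 2) {p : F} {v w : A} (hv : a * v = η • v) (hw : a * w = (1 / 2 : F) • w)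
    (e : p • a + v + w = 0) : p = 0 ∧ v = 0 ∧ w = 0 := by
  have e1 : p • a + η • v + (1 / 2 : F) • w = 0 := by
    have := congrArg (a * ·) e
    simpa only [mul_add, mul_smul_comm, idem, hv, hw, mul_zero] using this
  have e2 : (p * (1 - 1 / 2)) • a + (η - 1 / 2) • v = 0 := by
    linear_combination (norm := module) e1 - (1 / 2 : F) • e
  have e3 : (p * (1 - 1 / 2)) • a + ((η - 1 / 2) * η) • v = 0 := by
    have := congrArg (a * ·) e2
    simpa only [mul_add, mul_smul_comm, idem, hv, smul_smul, mul_zero] using this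
  have e4 : (p * (1 - 1 / 2) * (1 - η)) • a = 0 := by
    linear_combination (norm := module) e3 - η • e2
  have hp : p = 0 := by
    rcases smul_eq_zero.1 e4 with h' | h'
    · have h12 : (1 : F) - 1 / 2 ≠ 0 := by
        field_simp
        norm_num [h2]
      rcases mul_eq_zero.1 h' with h' | h'
      · exact (mul_eq_zero.1 h').resolve_right h12
      · exact absurd (sub_eq_zero.1 h').symm hη1
    · exact absurd h' ne_zero
  subst hp
  have hv0 : v = 0 := by
    rw [zero_mul, zero_smul, zero_add] at e2
    exact (smul_eq_zero.1 e2).resolve_left (sub_ne_zero.2 hη2)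
  subst hv0
  exact ⟨rfl, rfl, by simpa using e⟩

namespace IsPeirceAxis

theorem eq_zero_of_sum_eq_zero (h : IsPeirceAxis η a) (h2 : (2 : F) ≠ 0) (hη1 : η ≠ 1)
    (hη2 : η ≠ 1 / 2) {p : F} {v w : A} (hv : a * v = η • v) (hw : a * w = (1 / 2 : F) • w)
    (e : p • a + v + w = 0) : p = 0 ∧ v = 0 ∧ w = 0 :=
  eq_zero_of_peirce_sum_eq_zero h.idem h.ne_zero h2 hη1 hη2 hv hw e

theorem components_unique (h : IsPeirceAxis η a) (h2 : (2 : F) ≠ 0) (hη1 : η ≠ 1)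
    (hη2 : η ≠ 1 / 2) {p q : F} {v w v' w' : A} (hv : a * v = η • v)
    (hw : a * w = (1 / 2 : F) • w) (hv' : a * v' = η • v') (hw' : a * w' = (1 / 2 : F) • w')
    (e : p • a + v + w = q • a + v' + w') : p = q ∧ v = v' ∧ w = w' := by
  have := h.eq_zero_of_sum_eq_zero h2 hη1 hη2 (p := p - q) (v := v - v') (w := w - w')
    (by rw [mul_sub, hv, hv', smul_sub]) (by rw [mul_sub, hw, hw', smul_sub])
    (by linear_combination (norm := module) e)
  exact ⟨sub_eq_zero.1 this.1, sub_eq_zero.1 this.2.1, sub_eq_zero.1 this.2.2⟩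

/-- The Peirce components depend linearly on the vector. -/
theorem exists_linear_components (h : IsPeirceAxis η a) (h2 : (2 : F) ≠ 0) (hη1 : η ≠ 1)
    (hη2 : η ≠ 1 / 2) : ∃ (l : A →ₗ[F] F) (P Q : A →ₗ[F] A), ∀ u, u = l u • a + P u + Q u ∧
      a * P u = η • P u ∧ a * Q u = (1 / 2 : F) • Q u := by
  choose l P Q hu hP hQ using h.decomp
  have hadd : ∀ u v, l (u + v) = l u + l v ∧ P (u + v) = P u + P v ∧ Q (u + v) = Q u + Q v :=
    fun u v => h.components_unique h2 hη1 hη2 (hP _) (hQ _)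
      (by rw [mul_add, hP, hP, smul_add]) (by rw [mul_add, hQ, hQ, smul_add])
      (by linear_combination (norm := module) hu u + hu v - hu (u + v))
  have hsmul : ∀ (r : F) u, l (r • u) = r * l u ∧ P (r • u) = r • P u ∧ Q (r • u) = r • Q u :=
    fun r u => h.components_unique h2 hη1 hη2 (hP _) (hQ _)
      (by rw [mul_smul_comm, hP, smul_comm]) (by rw [mul_smul_comm, hQ, smul_comm])
      (by linear_combination (norm := module) r • hu u - hu (r • u))
  exact ⟨⟨⟨l, fun u v => (hadd u v).1⟩, fun r u => (hsmul r u).1⟩,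
    ⟨⟨P, fun u v => (hadd u v).2.1⟩, fun r u => (hsmul r u).2.1⟩,
    ⟨⟨Q, fun u v => (hadd u v).2.2⟩, fun r u => (hsmul r u).2.2⟩,
    fun u => ⟨hu u, hP u, hQ u⟩⟩

/-- The Miyamoto involution of an axis. -/
theorem exists_involution (h : IsPeirceAxis η a) (h2 : (2 : F) ≠ 0) (hη1 : η ≠ 1)
    (hη2 : η ≠ 1 / 2) : ∃ τ : A →ₗ[F] A, (∀ u v, τ (u * v) = τ u * τ v) ∧ (∀ u, τ (τ u) = u) ∧
      τ a = a ∧ (∀ v, a * v = η • v → τ v = v) ∧ ∀ w, a * w = (1 / 2 : F) • w → τ w = -w := by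
  obtain ⟨l, P, Q, hl⟩ := h.exists_linear_components h2 hη1 hη2
  -- The fusion law is graded by the group of order two with `A_{1/2}(a)` as the odd part, so the
  -- sign change on this part respects products.
  let τ : A →ₗ[F] A := l.smulRight a + P - Q
  have hτ : ∀ (p : F) (v w : A), a * v = η • v → a * w = (1 / 2 : F) • w →
      τ (p • a + v + w) = p • a + v - w := by
    intro p v w hv hw
    obtain ⟨e, hP, hQ⟩ := hl (p • a + v + w)
    obtain ⟨e1, e2, e3⟩ := h.components_unique h2 hη1 hη2 hv hw hP hQ e
    change l _ • a + P _ - Q _ = _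
    rw [← e1, ← e2, ← e3]
  have τa : τ a = a := by simpa using hτ 1 0 0 (by simp) (by simp)
  have τv : ∀ v, a * v = η • v → τ v = v := fun v hv => by simpa using hτ 0 v 0 hv (by simp)
  have τw : ∀ w, a * w = (1 / 2 : F) • w → τ w = -w := fun w hw => by
    simpa using hτ 0 0 w (by simp) hw
  refine ⟨τ, fun u u' => ?_, fun u => ?_, τa, τv, τw⟩
  · obtain ⟨p, v, w, rfl, hv, hw⟩ := h.decomp u
    obtain ⟨p', v', w', rfl, hv', hw'⟩ := h.decomp u'
    obtain ⟨s, hs⟩ := h.mul_eta_eta v v' hv hv'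
    obtain ⟨t, r, ht, hr⟩ := h.mul_half_half w w' hw hw'
    have k1 := τw _ (h.mul_eta_half v w' hv hw')
    have k2 := τw _ (h.mul_eta_half v' w hv' hw)
    simp only [mul_add, add_mul, smul_mul_assoc, mul_smul_comm, map_add, map_smul, τa, τv v hv,
      τv v' hv', τw w hw, τw w' hw', mul_neg, neg_mul, h.idem, hv, hv', hw, hw', hs, ht, mul_comm v a,
      mul_comm w a, k1, mul_comm w v', k2, τv r hr]
    module
  · obtain ⟨p, v, w, rfl, hv, hw⟩ := h.decomp u
    simp only [map_add, map_smul, τa, τv v hv, τw w hw, map_neg, neg_neg]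

/-- Applied to Miyamoto involutions. Since `τ` is its own inverse, it also carries eigenvectors of
`τ a` back to eigenvectors of `a`. -/
theorem map (h : IsPeirceAxis η a) {τ : A →ₗ[F] A} (hmul : ∀ u v, τ (u * v) = τ u * τ v)
    (hinv : ∀ u, τ (τ u) = u) : IsPeirceAxis η (τ a) := by
  have key : ∀ u (r : F), τ a * u = r • u → a * τ u = r • τ u := by
    intro u r e
    have := congrArg τ e
    rwa [hmul, hinv, map_smul] at this
  have key' : ∀ u (r : F), a * u = r • u → τ a * τ u = r • τ u := by
    intro u r e
    rw [← hmul, e, map_smul]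
  refine ⟨by rw [← hmul, h.idem], fun e => h.ne_zero ?_, fun u hu => ?_, fun u => ?_,
    fun u v hu hv => ?_, fun u v hu hv => ?_, fun u v hu hv => ?_⟩
  · rw [← hinv a, e, map_zero]
  · obtain ⟨p, hp⟩ := h.one_dim (τ u) (by simpa using key u 1 (by simpa using hu))
    exact ⟨p, by rw [← hinv u, hp, map_smul]⟩
  · obtain ⟨p, v, w, e, hv, hw⟩ := h.decomp (τ u)
    exact ⟨p, τ v, τ w, by rw [← hinv u, e, map_add, map_add, map_smul], key' _ _ hv, key' _ _ hw⟩
  · obtain ⟨p, hp⟩ := h.mul_eta_eta _ _ (key _ _ hu) (key _ _ hv)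
    exact ⟨p, by rw [← hinv (u * v), hmul, hp, map_smul]⟩
  · have := key' _ _ (h.mul_eta_half _ _ (key _ _ hu) (key _ _ hv))
    rwa [hmul, hinv, hinv] at this
  · obtain ⟨p, r, e, hr⟩ := h.mul_half_half _ _ (key _ _ hu) (key _ _ hv)
    exact ⟨p, τ r, by rw [← hinv (u * v), hmul, e, map_add, map_smul], key' _ _ hr⟩

end IsPeirceAxis

end PeirceAxis

/-! ### Coefficients of two axes along each other -/

section Frobenius

variable {F A : Type*} [Field F] [NonUnitalNonAssocCommRing A] [Module F A]
  [IsScalarTower F A A] [SMulCommClass F A A] {η : F} {a b : A}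

namespace IsPeirceAxis

/-- The coefficients of two axes along each other coincide, and are equal to `1` if `η ≠ -1`. -/
theorem coeff_symm (h2 : (2 : F) ≠ 0) (hη1 : η ≠ 1) (hη2 : η ≠ 1 / 2)
    (ha : IsPeirceAxis η a) (hb : IsPeirceAxis η b) {l m : F} {u v u' v' : A}
    (e : b = l • a + u + v) (hu : a * u = η • u) (hv : a * v = (1 / 2 : F) • v)
    (e' : a = m • b + u' + v') (hu' : b * u' = η • u') (hv' : b * v' = (1 / 2 : F) • v') :
    l = m ∧ (η ≠ -1 → l = 1) := by
  have hη2' : 2 * η - 1 ≠ 0 := fun h => hη2 (by field_simp; linear_combination h)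
  have hη1' : 1 - η ≠ 0 := fun h => hη1 (by linear_combination -h)
  obtain ⟨k, hk⟩ := ha.mul_eta_eta u u hu hu
  obtain ⟨t, r, ht, hr⟩ := ha.mul_half_half v v hv hv
  have huv := ha.mul_eta_half u v hu hv
  -- The Peirce components of `b * b = b`; they express `t`, `r` and `u * v` through `l`, `k`, `u`
  -- and `v`.
  have sq : (l ^ 2 + k + t) • a + ((2 * l * η) • u + r) + (l • v + (2 : F) • (u * v)) =
      l • a + u + v := by
    have := hb.idem
    rw [e] at this
    simp only [mul_add, add_mul, smul_mul_assoc, mul_smul_comm, ha.idem, hu, hv, mul_comm u a,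
      mul_comm v a, hk, ht, mul_comm v u] at this
    have hh : l • v = l • (1 / 2 : F) • v + l • (1 / 2 : F) • v := by
      rw [← smul_add, ← add_smul]
      congr 1
      rw [show (1 / 2 : F) + 1 / 2 = 1 by field_simp; norm_num, one_smul]
    rw [hh]
    linear_combination (norm := module) this
  obtain ⟨s1, s2, s3⟩ := ha.components_unique h2 hη1 hη2
    (by simp only [mul_add, mul_smul_comm, hu, hr]; module)
    (by simp only [mul_add, mul_smul_comm, hv, huv]; module) hu hv sq
  have hr' : r = (1 - 2 * l * η) • u := by linear_combination (norm := module) s2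
  have huv' : u * v = ((1 - l) / 2) • v := by
    have : (2 : F) • (u * v) = (1 - l) • v := by linear_combination (norm := module) s3
    rw [← inv_smul_smul₀ h2 (u * v), this, smul_smul]
    congr 1
    field_simp
  have ht' : t = l - l ^ 2 - k := by linear_combination s1
  -- The operator `(ad b - η)(ad b - 1/2)` kills `u'` and `v'` and multiplies `b` by `(1 - η)/2`.
  -- Both sides are then expanded with respect to `a`, giving one equation per Peirce component.
  have rel : b * (b * a) - (η + 1 / 2) • (b * a) + (η / 2) • a = ((1 - η) / 2 * m) • b := by
    have h1 : b * a = m • b + η • u' + (1 / 2 : F) • v' := by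
      conv_lhs => rw [e']
      simp only [mul_add, mul_smul_comm, hb.idem, hu', hv']
    have h1' : b * (b * a) = m • b + (η * η) • u' + (1 / 2 * (1 / 2) : F) • v' := by
      conv_lhs => rw [h1]
      simp only [mul_add, mul_smul_comm, hb.idem, hu', hv', smul_smul]
    have h3 : (η / 2) • a = (η / 2) • (m • b + u' + v') := by rw [← e']
    have h4 : (1 - η) / 2 * m = m - (η + 1 / 2) * m + η / 2 * m := by field_simp; ring
    rw [h1', h1, h3, h4]
    module
  have hba : b * a = l • a + η • u + (1 / 2 : F) • v := by
    rw [mul_comm, e]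
    simp only [mul_add, mul_smul_comm, ha.idem, hu, hv]
  rw [hba, e] at rel
  simp only [mul_add, add_mul, smul_mul_assoc, mul_smul_comm, ha.idem, hu, hv, mul_comm u a,
      mul_comm v a, hk, ht, mul_comm v u, huv', hr', ht', smul_smul] at rel
  obtain ⟨c1, c2, c3⟩ := ha.components_unique h2 hη1 hη2
    (p := l ^ 2 + η * k + (l - l ^ 2 - k) / 2 - (η + 1 / 2) * l + η / 2)
    (q := (1 - η) / 2 * m * l)
    (v := (l * η ^ 2 + l * η + (1 - 2 * l * η) / 2 - (η + 1 / 2) * η) • u)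
    (v' := ((1 - η) / 2 * m) • u)
    (w := (l / 2 + l / 2 / 2 + (η + 1 / 2) * ((1 - l) / 2) - (η + 1 / 2) / 2) • v)
    (w' := ((1 - η) / 2 * m) • v)
    (by simp only [mul_smul_comm, hu]; module) (by simp only [mul_smul_comm, hv]; module)
    (by simp only [mul_smul_comm, hu]; module) (by simp only [mul_smul_comm, hv]; module)
    (by linear_combination (norm := module) rel)
  -- If `v = 0`, the third equation is void. Then either `u = 0` and `b = a`, or idempotence gives
  -- `2 * l * η = 1`, which will force `η = -1` and `l = -1/2`.
  by_cases v0 : v = 0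
  · by_cases u0 : u = 0
    · subst v0 u0
      rw [add_zero, add_zero] at e
      have hl : l = 1 := by
        have l0 : l ≠ 0 := by
          rintro rfl
          exact hb.ne_zero (by simpa using e)
        have := hb.idem
        rw [e, smul_mul_smul_comm, ha.idem] at this
        have := smul_left_injective F ha.ne_zero this
        exact mul_left_cancel₀ l0 (by linear_combination this)
      subst hl
      rw [one_smul] at e
      subst e
      have := (hb.components_unique h2 hη1 hη2 (v := 0) (w := 0) (by simp) (by simp) hu' hv'
        (p := 1) (by rw [← e']; simp)).1
      exact ⟨this, fun _ => rfl⟩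
    · have d2 := smul_left_injective F u0 c2
      have d : 2 * l * η = 1 := by
        have : r = 0 := by
          have := ht
          rw [v0, mul_zero] at this
          exact (ha.eq_zero_of_sum_eq_zero h2 hη1 hη2 (v := r) (w := 0) hr (by simp)
            (by rw [← this, add_zero])).2.1
        rw [this] at hr'
        linear_combination -(smul_eq_zero.1 hr'.symm).resolve_right u0
      have t0 : l - l ^ 2 - k = 0 := by
        have := ht
        rw [v0, mul_zero] at this
        rw [← ht']
        exact (ha.eq_zero_of_sum_eq_zero h2 hη1 hη2 (v := r) (w := 0) hr (by simp)
            (by rw [← this, add_zero])).1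
      -- The combination `c1 - l * d2` eliminates `m`, then `t0` eliminates `k`, and `d` eliminates
      -- `l`.
      have f1 : (η + 1) * (2 * η - 1) ^ 2 = 0 := by
        field_simp at c1 d2
        refine mul_left_cancel₀ h2 ?_
        linear_combination 4 * η ^ 2 * (c1 - l * d2 + (2 * η - 1) * t0) -
          ((2 - 2 * η - 2 * η ^ 2) * (1 + 2 * l * η) + (-4 * η + 4 * η ^ 3 + 2 * η ^ 2)) * d
      have f2 : η = -1 := by
        rcases mul_eq_zero.1 f1 with h | h
        · linear_combination h
        · exact absurd (pow_eq_zero_iff two_ne_zero |>.1 h) hη2'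
      subst f2
      refine ⟨?_, fun h => absurd rfl h⟩
      field_simp at d2
      exact mul_left_cancel₀ h2 (by linear_combination d2)
  -- For `v ≠ 0` the third equation is `(1 - η)(l - m) = 0`. If `u = 0`, then `u * v = 0` gives `l =
  -- 1`; otherwise the second equation becomes `(2η - 1)(η + 1)(l - 1) = 0`.
  · have d3 := smul_left_injective F v0 c3
    have lm : l = m := by
      have : (1 - η) * (l - m) = 0 := by
        field_simp at d3
        exact mul_left_cancel₀ h2 (by linear_combination d3)
      linear_combination (mul_eq_zero.1 this).resolve_left hη1'
    refine ⟨lm, fun hη => ?_⟩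
    by_cases u0 : u = 0
    · subst u0
      rw [zero_mul] at huv'
      have := (smul_eq_zero.1 huv'.symm).resolve_right v0
      field_simp at this
      linear_combination -this
    · have d2 := smul_left_injective F u0 c2
      rw [← lm] at d2
      have : (2 * η - 1) * ((η + 1) * (l - 1)) = 0 := by
        field_simp at d2
        linear_combination d2
      have := ((mul_eq_zero.1 this).resolve_left hη2')
      linear_combination (mul_eq_zero.1 this).resolve_left (fun h => hη (by linear_combination h))

end IsPeirceAxis
end Frobenius

/-! ### Spanning by axes and the Frobenius form -/

section FrobeniusForm

variable {F A : Type*} [Field F] [NonUnitalNonAssocCommRing A] [Module F A]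
  [IsScalarTower F A A] [SMulCommClass F A A] {η : F}

/-- An algebra generated by primitive axes is spanned by its primitive axes. -/
theorem span_isPeirceAxis_eq_top (h2 : (2 : F) ≠ 0) (hη1 : η ≠ 1) (hη2 : η ≠ 1 / 2) {X : Set A}
    (hX : ∀ a ∈ X, IsPeirceAxis η a) (hgen : NonUnitalAlgebra.adjoin F X = ⊤) :
    Submodule.span F {a : A | IsPeirceAxis η a} = ⊤ := by
  set S := Submodule.span F {a : A | IsPeirceAxis η a} with hS
  -- For `b = p • a + v + w` the vector `p • a + v - w` is again an axis, being the image of `b`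
  -- under the involution of `a`. Hence `v` and `w` are in the span, and with them `a * b`.
  have hab : ∀ a b : A, IsPeirceAxis η a → IsPeirceAxis η b → a * b ∈ S := by
    intro a b ha hb
    obtain ⟨τ, hmul, hinv, τa, τv, τw⟩ := ha.exists_involution h2 hη1 hη2
    have hτb : τ b ∈ S := Submodule.subset_span (hb.map hmul hinv)
    have hbS : b ∈ S := Submodule.subset_span hb
    have haS : a ∈ S := Submodule.subset_span ha
    obtain ⟨p, v, w, rfl, hv, hw⟩ := ha.decomp b
    simp only [map_add, map_smul, τa, τv v hv, τw w hw] at hτb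
    have hw' : w ∈ S := by
      have : (2 : F) • w ∈ S := by
        have := S.sub_mem hbS hτb
        rwa [show p • a + v + w - (p • a + v + -w) = (2 : F) • w by module] at this
      rw [← inv_smul_smul₀ h2 w]
      exact S.smul_mem _ this
    have hv' : v ∈ S := by
      have := S.sub_mem (S.sub_mem hbS hw') (S.smul_mem p haS)
      rwa [show p • a + v + w - w - p • a = v by module] at this
    simp only [mul_add, mul_smul_comm, ha.idem, hv, hw]
    exact S.add_mem (S.add_mem (S.smul_mem _ haS) (S.smul_mem _ hv')) (S.smul_mem _ hw')
  have hmul : ∀ u ∈ S, ∀ v ∈ S, u * v ∈ S := by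
    intro u hu v hv
    induction hu using Submodule.span_induction with
    | mem a ha =>
      induction hv using Submodule.span_induction with
      | mem b hb => exact hab a b ha hb
      | zero => simp
      | add x y _ _ hx hy => rw [mul_add]; exact S.add_mem hx hy
      | smul r x _ hx => rw [mul_smul_comm]; exact S.smul_mem r hx
    | zero => simp
    | add x y _ _ hx hy => rw [add_mul]; exact S.add_mem hx hy
    | smul r x _ hx => rw [smul_mul_assoc]; exact S.smul_mem r hx
  let S' : NonUnitalSubalgebra F A := { S with mul_mem' := fun {u v} hu hv => hmul u hu v hv }
  have : (⊤ : NonUnitalSubalgebra F A) ≤ S' := by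
    rw [← hgen]
    exact NonUnitalAlgebra.adjoin_le fun a ha => Submodule.subset_span (hX a ha)
  exact eq_top_iff.2 fun u _ => this (by trivial : u ∈ (⊤ : NonUnitalSubalgebra F A))

/-- An algebra spanned by primitive axes has a symmetric associative form whose values on an axis
are the coefficients along this axis. -/
theorem exists_frobenius_form (h2 : (2 : F) ≠ 0) (hη1 : η ≠ 1) (hη2 : η ≠ 1 / 2)
    (hspan : Submodule.span F {a : A | IsPeirceAxis η a} = ⊤) :
    ∃ B : LinearMap.BilinForm F A, (∀ u v, B u v = B v u) ∧
      (∀ u v w, B (u * v) w = B u (v * w)) ∧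
      (∀ a, IsPeirceAxis η a → B a a = 1) ∧
      (η ≠ -1 → ∀ a b, IsPeirceAxis η a → IsPeirceAxis η b → B a b = 1) := by
  have hlin : ∀ a : {a : A | IsPeirceAxis η a}, ∃ l : A →ₗ[F] F, ∀ u, ∃ v w : A,
      u = l u • a.1 + v + w ∧ a.1 * v = η • v ∧ a.1 * w = (1 / 2 : F) • w := by
    intro a
    obtain ⟨l, P, Q, h⟩ := a.2.exists_linear_components h2 hη1 hη2
    exact ⟨l, fun u => ⟨P u, Q u, h u⟩⟩
  choose l hl using hlin
  have lsymm : ∀ a b : {a : A | IsPeirceAxis η a}, l a b = l b a := by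
    intro a b
    obtain ⟨u, v, e, hu, hv⟩ := hl a b
    obtain ⟨u', v', e', hu', hv'⟩ := hl b a
    exact (a.2.coeff_symm h2 hη1 hη2 b.2 e hu hv e' hu' hv').1
  have lone : η ≠ -1 → ∀ a b : {a : A | IsPeirceAxis η a}, l a b = 1 := by
    intro h a b
    obtain ⟨u, v, e, hu, hv⟩ := hl a b
    obtain ⟨u', v', e', hu', hv'⟩ := hl b a
    exact (a.2.coeff_symm h2 hη1 hη2 b.2 e hu hv e' hu' hv').2 h
  -- A basis made of axes defines the form through its rows. Symmetry of the coefficients then shows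
  -- that every axis, in the basis or not, has its coefficient function as row.
  let bs := Module.Basis.ofSpan hspan.ge
  have hbs : ∀ i, IsPeirceAxis η (bs i) := fun i =>
    Module.Basis.ofSpan_subset hspan.ge (Set.mem_range_self i)
  let B : LinearMap.BilinForm F A := bs.constr F fun i => l ⟨bs i, hbs i⟩
  have hBi : ∀ i, B (bs i) = l ⟨bs i, hbs i⟩ := fun i => bs.constr_basis F _ i
  have hBr : ∀ b : {a : A | IsPeirceAxis η a}, B.flip b.1 = l b := by
    intro b
    refine bs.ext fun i => ?_
    change B (bs i) b.1 = _
    rw [hBi]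
    exact lsymm ⟨bs i, hbs i⟩ b
  have hsymm : ∀ u v, B u v = B v u := by
    have : B = B.flip := bs.ext fun i => by rw [hBi, hBr ⟨bs i, hbs i⟩]
    intro u v
    conv_lhs => rw [this]
    rfl
  have hB : ∀ b : {a : A | IsPeirceAxis η a}, ∀ u, B b.1 u = l b u := by
    intro b u
    rw [hsymm, ← hBr b]
    rfl
  have hone : ∀ a, IsPeirceAxis η a → B a a = 1 := by
    intro a ha
    rw [hB ⟨a, ha⟩]
    obtain ⟨v, w, e, hv, hw⟩ := hl ⟨a, ha⟩ a
    exact ((ha.components_unique h2 hη1 hη2 (p := 1) (v := 0) (w := 0) (by simp) (by simp) hv hw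
      (by rw [← e]; simp)).1).symm
  have haxis : ∀ a, IsPeirceAxis η a → ∀ u, ∃ v w : A, u = B a u • a + v + w ∧ a * v = η • v ∧
      a * w = (1 / 2 : F) • w := by
    intro a ha u
    rw [hB ⟨a, ha⟩]
    exact hl ⟨a, ha⟩ u
  -- An involutive automorphism carries the decomposition for an axis to the decomposition for its
  -- image, hence preserves coefficients.
  have hinvar : ∀ τ : A →ₗ[F] A, (∀ u v, τ (u * v) = τ u * τ v) → (∀ u, τ (τ u) = u) →
      ∀ u v, B (τ u) (τ v) = B u v := by
    intro τ hmul hinv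
    have : B.compl₁₂ τ τ = B := by
      refine bs.ext fun i => LinearMap.ext fun v => ?_
      have hi := (hbs i).map hmul hinv
      obtain ⟨v', w', e, hv', hw'⟩ := haxis _ (hbs i) v
      obtain ⟨v'', w'', e', hv'', hw''⟩ := haxis _ hi (τ v)
      rw [LinearMap.compl₁₂_apply]
      refine (hi.components_unique h2 hη1 hη2 (v := τ v') (w := τ w') ?_ ?_ hv'' hw'' ?_).1.symm
      · rw [← hmul, hv', map_smul]
      · rw [← hmul, hw', map_smul]
      · rw [← e', ← map_smul, ← map_add, ← map_add, ← e]
    intro u v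
    exact LinearMap.congr_fun (LinearMap.congr_fun this u) v
  have hself : ∀ a, IsPeirceAxis η a → ∀ u v, B (a * u) v = B u (a * v) := by
    intro a ha
    have o1 : ∀ v, a * v = η • v → B a v = 0 := by
      intro v hv
      obtain ⟨v', w', e, hv', hw'⟩ := haxis a ha v
      exact ((ha.components_unique h2 hη1 hη2 (p := 0) (w := 0) hv (by simp) hv' hw'
        (by rw [← e]; simp)).1).symm
    have o2 : ∀ w, a * w = (1 / 2 : F) • w → B a w = 0 := by
      intro w hw
      obtain ⟨v', w', e, hv', hw'⟩ := haxis a ha w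
      exact ((ha.components_unique h2 hη1 hη2 (p := 0) (v := 0) (by simp) hw hv' hw'
        (by rw [← e]; simp)).1).symm
    -- The involution of `a` fixes `v` and negates `w`, so `B v w = -B v w`.
    have o3 : ∀ v w, a * v = η • v → a * w = (1 / 2 : F) • w → B v w = 0 := by
      intro v w hv hw
      obtain ⟨τ, hmul, hinv, τa, τv, τw⟩ := ha.exists_involution h2 hη1 hη2
      have := hinvar τ hmul hinv v w
      rw [τv v hv, τw w hw, map_neg] at this
      exact (mul_eq_zero.1 (show 2 * B v w = 0 by linear_combination -this)).resolve_left h2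
    intro u v
    obtain ⟨p, y, z, rfl, hy, hz⟩ := ha.decomp u
    obtain ⟨q, y', z', rfl, hy', hz'⟩ := ha.decomp v
    simp only [mul_add, mul_smul_comm, ha.idem, hy, hz, hy', hz', map_add, map_smul,
      LinearMap.add_apply, LinearMap.smul_apply, smul_eq_mul, o1 y hy, o2 z hz, o1 y' hy',
      o2 z' hz', hsymm y a, hsymm z a, hsymm z y', o3 y z' hy hz', o3 y' z hy' hz]
    ring
  refine ⟨B, hsymm, ?_, hone, ?_⟩
  · intro u v w
    -- Associativity is linear in the middle factor, and for an axis in the middle it is the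
    -- self-adjointness of `ad a`.
    have hv : v ∈ Submodule.span F {a : A | IsPeirceAxis η a} := hspan ▸ Submodule.mem_top
    induction hv using Submodule.span_induction with
    | mem a ha => rw [mul_comm u a]; exact hself a ha u w
    | zero => simp
    | add x y _ _ hx hy => rw [mul_add, add_mul, map_add, map_add, LinearMap.add_apply, hx, hy]
    | smul r x _ hx =>
      rw [mul_smul_comm, smul_mul_assoc, map_smul, map_smul, LinearMap.smul_apply, hx]
  · intro hη a b ha hb
    rw [hB ⟨a, ha⟩]
    exact lone hη ⟨a, ha⟩ ⟨b, hb⟩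

/-- A symmetric associative form with `(a, a) = 1` for all primitive axes `a` is unique. -/
theorem frobenius_form_unique (hη1 : η ≠ 1) (h12 : (1 / 2 : F) ≠ 1)
    (hspan : Submodule.span F {a : A | IsPeirceAxis η a} = ⊤) {B C : LinearMap.BilinForm F A}
    (hB : ∀ u v w, B (u * v) w = B u (v * w)) (hC : ∀ u v w, C (u * v) w = C u (v * w))
    (hB1 : ∀ a, IsPeirceAxis η a → B a a = 1) (hC1 : ∀ a, IsPeirceAxis η a → C a a = 1) :
    B = C := by
  -- Associativity makes an idempotent orthogonal to its eigenvectors for eigenvalues other than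
  -- `1`, so both forms take as value at `a` and `u` the coefficient of `u` along `a`.
  have orth : ∀ (D : LinearMap.BilinForm F A), (∀ u v w, D (u * v) w = D u (v * w)) →
      ∀ a : A, a * a = a → ∀ (r : F) v, r ≠ 1 → a * v = r • v → D a v = 0 := by
    intro D hD a ha r v hr hv
    have := hD a a v
    rw [ha, hv, map_smul, smul_eq_mul] at this
    have h : (r - 1) * D a v = 0 := by linear_combination -this
    exact (mul_eq_zero.1 h).resolve_left (sub_ne_zero.2 hr)
  refine LinearMap.ext_on hspan fun a ha => LinearMap.ext fun u => ?_
  obtain ⟨p, v, w, rfl, hv, hw⟩ := IsPeirceAxis.decomp ha u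
  simp only [map_add, map_smul, orth B hB a ha.idem _ v hη1 hv, orth B hB a ha.idem _ w h12 hw,
    orth C hC a ha.idem _ v hη1 hv, orth C hC a ha.idem _ w h12 hw, hB1 a ha, hC1 a ha]

/-! ### The cubic identity in algebras spanned by axes -/

/-- The linearized cubic identity. -/
def CubicIdentity (η : F) (B : A → A → F) (l : A → F) (x y z : A) : Prop :=
  -- The polarization of `x³ = (1 + η) l(x) x² - η B(x, x) x`.
  x * y * z + y * z * x + z * x * y =
    (1 + η) • (l x • (y * z) + l y • (z * x) + l z • (x * y)) -
      η • (B x y • z + B y z • x + B z x • y)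

/-- An algebra spanned by primitive axes satisfies the linearized cubic identity. -/
theorem cubicIdentity_of_span_axes (h2 : (2 : F) ≠ 0) (hη1 : η ≠ 1)
    (hη2 : η ≠ 1 / 2) (hspan : Submodule.span F {a : A | IsPeirceAxis η a} = ⊤) {B : LinearMap.BilinForm F A}
    (hsymm : ∀ u v, B u v = B v u) (hB : ∀ u v w, B (u * v) w = B u (v * w))
    (hB1 : ∀ a, IsPeirceAxis η a → B a a = 1) {c : A}
    (hc : IsPeirceAxis η c)
    (hw : η ≠ -1 → ∀ a b, IsPeirceAxis η a → IsPeirceAxis η b → B a b = 1) (x y z : A) :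
    CubicIdentity η (fun u v => B u v) (B c) x y z := by
  have orth : ∀ (r s : F) (a u v : A), r ≠ s → a * u = r • u → a * v = s • v → B u v = 0 := by
    intro r s a u v hrs hu hv
    have := hB u a v
    rw [mul_comm u a, hu, hv, map_smul, map_smul, LinearMap.smul_apply, smul_eq_mul,
      smul_eq_mul] at this
    have h : (r - s) * B u v = 0 := by linear_combination this
    exact (mul_eq_zero.1 h).resolve_left (sub_ne_zero.2 hrs)
  have h12 : (1 / 2 : F) ≠ 1 := by
    intro e
    rw [div_eq_iff h2] at e
    have : (2 : F) - 1 = 0 := by linear_combination -e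
    norm_num at this
  -- Linearity in `x` reduces the claim to an axis `x = a`. With `y` and `z` split into Peirce
  -- components, the fusion law gives all products up to the coefficients `s` and `t` along `a`,
  -- which associativity expresses by the form.
  have hx : x ∈ Submodule.span F {a : A | IsPeirceAxis η a} := hspan ▸ Submodule.mem_top
  induction hx using Submodule.span_induction with
  | mem a ha =>
    obtain ⟨p, u, v, rfl, hu, hv⟩ := IsPeirceAxis.decomp ha y
    obtain ⟨p', u', v', rfl, hu', hv'⟩ := IsPeirceAxis.decomp ha z
    have haa : a * a = a := ha.idem
    have ha1 : a * a = (1 : F) • a := by rw [one_smul, haa]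
    obtain ⟨s, hs⟩ := ha.mul_eta_eta u u' hu hu'
    obtain ⟨t, r, ht, hr⟩ := ha.mul_half_half v v' hv hv'
    have a1 := hB1 a ha
    have au := orth _ _ a a u hη1.symm ha1 hu
    have au' := orth _ _ a a u' hη1.symm ha1 hu'
    have av := orth _ _ a a v h12.symm ha1 hv
    have av' := orth _ _ a a v' h12.symm ha1 hv'
    have ar := orth _ _ a a r hη1.symm ha1 hr
    have uv := orth _ _ a u v' hη2 hu hv'
    have uv' := orth _ _ a u' v hη2 hu' hv
    have hs' : s = η * B u u' := by
      have := hB a u u'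
      rw [hu, hs, map_smul, map_smul, LinearMap.smul_apply, smul_eq_mul, smul_eq_mul, a1] at this
      linear_combination -this
    have ht' : t = 1 / 2 * B v v' := by
      have := hB a v v'
      rw [hv, ht, map_smul, map_add, map_smul, LinearMap.smul_apply, smul_eq_mul, smul_eq_mul, a1,
        ar] at this
      linear_combination -this
    have huv := ha.mul_eta_half u v' hu hv'
    have huv' := ha.mul_eta_half u' v hu' hv
    have htt : B v v' = 2 * t := by rw [ht']; field_simp
    have hh : 2 * (1 / 2 : F) = 1 := by field_simp
    -- From here on `2 * h = 1` is all that is needed about `1/2`.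
    generalize (1 / 2 : F) = h at *
    by_cases hη : η = -1
    · have hss : B u u' = -s := by rw [hs', hη]; ring
      subst hη
      simp only [CubicIdentity, add_neg_cancel, zero_smul, mul_add, add_mul, smul_mul_assoc,
        mul_smul_comm, haa, hu, hu', hv, hv', mul_comm u a, mul_comm v a, mul_comm u' a,
        mul_comm v' a, mul_comm u' u, mul_comm v' v, mul_comm v u', mul_comm v' u, hs, ht, map_add,
        map_smul, LinearMap.add_apply, LinearMap.smul_apply, smul_eq_mul, a1, au, au', av, av',
        uv, uv', htt, hss, huv, huv', mul_comm r a, hr, hsymm u a, hsymm u' a, hsymm v a, hsymm v' a,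
        hsymm v u', mul_comm (u * v') a, mul_comm (u' * v) a]
      linear_combination (norm := module) hh • (((h + 1) * p') • v + ((h + 1) * p) • v' + u * v' + u' * v + t • a + r)
    -- For `η ≠ -1` all axes have the same row and `B x y = B a x * B a y`. So vectors orthogonal to
    -- `a` are orthogonal to each other, and `s` and `t` vanish.
    · have hca : ∀ x, B c x = B a x := by
        refine LinearMap.congr_fun (LinearMap.ext_on hspan fun b hb => ?_)
        rw [hw hη c b hc hb, hw hη a b ha hb]
      have hprod : ∀ x y, B x y = B a x * B a y := by
        have : B = (B a).smulRight (B a) := by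
          refine LinearMap.ext_on hspan fun b hb => ?_
          rw [LinearMap.smulRight_apply, hw hη a b ha hb, one_smul]
          refine LinearMap.ext_on hspan fun d hd => ?_
          rw [hw hη a d ha hd, hw hη b d hb hd]
        intro x y
        exact LinearMap.congr_fun (LinearMap.congr_fun this x) y
      have uu0 : B u u' = 0 := by rw [hprod, au, zero_mul]
      have vv0 : B v v' = 0 := by rw [hprod, av, zero_mul]
      rw [uu0, mul_zero] at hs'
      rw [vv0, mul_zero] at ht'
      simp only [CubicIdentity, hca, mul_add, add_mul, smul_mul_assoc,
        mul_smul_comm, haa, hu, hu', hv, hv', mul_comm u a, mul_comm v a, mul_comm u' a,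
        mul_comm v' a, mul_comm u' u, mul_comm v' v, mul_comm v u', mul_comm v' u, hs, ht, map_add,
        map_smul, LinearMap.add_apply, LinearMap.smul_apply, smul_eq_mul, a1, au, au', av, av',
        uv, uv', uu0, vv0, hs', ht', huv, huv', mul_comm r a, hr, hsymm u a, hsymm u' a, hsymm v a, hsymm v' a,
        hsymm v u', mul_comm (u * v') a, mul_comm (u' * v) a]
      linear_combination (norm := module) hh • (((h - η) * p') • v + ((h - η) * p) • v' + u * v' + u' * v + r)
  | zero => simp [CubicIdentity]
  | add u v _ _ hu hv =>
    simp only [CubicIdentity, add_mul, mul_add, map_add, LinearMap.add_apply] at hu hv ⊢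
    linear_combination (norm := module) hu + hv
  | smul r u _ hu =>
    simp only [CubicIdentity, smul_mul_assoc, mul_smul_comm, map_smul, LinearMap.smul_apply,
      smul_eq_mul] at hu ⊢
    linear_combination (norm := module) r • hu

end FrobeniusForm

/-! ### From the cubic identity back to axes -/

section CubicIdentity

variable {F A : Type*} [Field F] [NonUnitalNonAssocCommRing A] [Module F A]
  [IsScalarTower F A A] [SMulCommClass F A A] {η : F}

/-- An idempotent that satisfies the cubic identity for a suitable form is a primitive axis. -/
theorem isPeirceAxis_of_cubicIdentity (h2 : (2 : F) ≠ 0) (hη1 : η ≠ 1) (hη2 : η ≠ 1 / 2) {a : A}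
    (idem : a * a = a) (h0 : a ≠ 0) {B : LinearMap.BilinForm F A} {l : A → F}
    (hB1 : B a a = 1) (hsymm : ∀ u, B u a = B a u)
    (hB : ∀ u v, B (a * u) v = B u (a * v))
    (hl : ∀ u, (1 + η) * l u = (1 + η) * B a u)
    (hT : ∀ y z, CubicIdentity η (fun u v => B u v) l a y z) : IsPeirceAxis η a := by
  have hη1' : 1 - η ≠ 0 := fun h => hη1 (by linear_combination -h)
  have hη2' : η - 1 / 2 ≠ 0 := sub_ne_zero.2 hη2
  have hhalf : 2 * (1 / 2 : F) = 1 := by field_simp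
  have h12 : (1 / 2 : F) ≠ 1 := by
    intro e
    rw [e] at hhalf
    have : (2 : F) - 1 = 0 := by linear_combination hhalf
    norm_num at this
  -- Since `l` enters only with the factor `1 + η`, the hypothesis `hl` allows replacing it by `B
  -- a`.
  have hT' : ∀ y z, a * y * z + y * z * a + z * a * y = (1 + η) • (y * z) +
      ((1 + η) * B a y) • (z * a) + ((1 + η) * B a z) • (a * y) -
      η • (B a y • z + B y z • a + B z a • y) := by
    intro y z
    rw [hT y z, ← hl y, ← hl z]
    have := hl a
    rw [hB1, mul_one] at this
    linear_combination (norm := module) this • (y * z)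
  have orth : ∀ (r s : F) (u v : A), r ≠ s → a * u = r • u → a * v = s • v → B u v = 0 := by
    intro r s u v hrs hu hv
    have := hB u v
    rw [hu, hv, map_smul, map_smul, LinearMap.smul_apply, smul_eq_mul, smul_eq_mul] at this
    have h : (r - s) * B u v = 0 := by linear_combination this
    exact (mul_eq_zero.1 h).resolve_left (sub_ne_zero.2 hrs)
  have ha1 : a * a = (1 : F) • a := by rw [one_smul, idem]
  have orth' : ∀ (r : F) v, r ≠ 1 → a * v = r • v → B a v = 0 ∧ B v a = 0 := fun r v hr hv =>
    ⟨orth 1 r a v hr.symm ha1 hv, orth r 1 v a hr hv ha1⟩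
  -- The identity for `a, a, z`. On the orthogonal complement of `a` it says `(2 ad a - 1)(ad a - η)
  -- = 0`, which provides the projections to the eigenspaces used in `decomp`.
  have quad : ∀ z, (2 : F) • (a * (a * z)) =
      (1 + 2 * η) • (a * z) - η • z + ((1 - η) * B a z) • a := by
    intro z
    have := hT' a z
    rw [idem, mul_comm (a * z) a, mul_comm z a, mul_comm (a * z) a, hB1, hsymm] at this
    linear_combination (norm := module) this
  have decomp : ∀ u, ∃ (p : F) (v w : A), u = p • a + v + w ∧ a * v = η • v ∧
      a * w = (1 / 2 : F) • w := by
    intro u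
    obtain ⟨z, hz⟩ : ∃ z, z = u - B a u • a := ⟨_, rfl⟩
    have q := quad z
    have hz0 : B a z = 0 := by
      rw [hz, map_sub, map_smul, hB1, smul_eq_mul, mul_one, sub_self]
    rw [hz0, mul_zero, zero_smul, add_zero] at q
    refine ⟨B a u, (η - 1 / 2)⁻¹ • (a * z - (1 / 2 : F) • z), (η - 1 / 2)⁻¹ • (η • z - a * z),
      ?_, ?_, ?_⟩
    · have : z = (η - 1 / 2)⁻¹ • (a * z - (1 / 2 : F) • z) + (η - 1 / 2)⁻¹ • (η • z - a * z) := by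
        rw [← smul_add, ← inv_smul_smul₀ hη2' z]
        congr 1
        rw [inv_smul_smul₀ hη2' z]
        module
      rw [add_assoc, ← this, hz]
      module
    · rw [mul_smul_comm, smul_comm η]
      congr 1
      rw [mul_sub, mul_smul_comm]
      linear_combination (norm := module) (1 / 2 : F) • q - hhalf • (a * (a * z) - η • (a * z))
    · rw [mul_smul_comm, smul_comm (1 / 2 : F)]
      congr 1
      rw [mul_sub, mul_smul_comm]
      linear_combination (norm := module) - (1 / 2 : F) • q + hhalf • (a * (a * z) - η • (a * z))
  refine ⟨idem, h0, fun u hu => ⟨B a u, ?_⟩, decomp, fun u v hu hv => ?_, fun u v hu hv => ?_,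
    fun u v hu hv => ?_⟩
  · have := quad u
    rw [hu, hu] at this
    refine smul_right_injective A hη1' ?_
    linear_combination (norm := module) this
  -- For `u ∈ A_r(a)` and `v ∈ A_s(a)` with `r, s ≠ 1` the identity reads `a(uv) = (1 + η - r - s)
  -- uv - η (u, v) a`. For `r = s = η` the factor is `1 - η`, which differs from `η` and from `1/2`
  -- because `η ≠ 1/2`; so `uv` has no component in these eigenspaces.
  · have e := hT' u v
    rw [(orth' _ u hη1 hu).1, (orth' _ v hη1 hv).1, (orth' _ v hη1 hv).2, mul_comm v a, hu, hv,
      smul_mul_assoc, smul_mul_assoc, mul_comm v u, mul_comm _ a] at e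
    obtain ⟨p, y, w, e', hy, hw⟩ := decomp (u * v)
    rw [e'] at e
    simp only [mul_add, mul_smul_comm, idem, hy, hw] at e
    obtain ⟨-, k1, k2⟩ := eq_zero_of_peirce_sum_eq_zero idem h0 h2 hη1 hη2
      (p := p * η + η * B u v) (v := (2 * η - 1) • y + (η - η) • y) (w := (η - 1 / 2) • w)
      (by simp only [mul_add, mul_smul_comm, hy]; module)
      (by simp only [mul_smul_comm, hw]; module)
      (by linear_combination (norm := module) e - hhalf • w)
    have k1' : (2 * (η - 1 / 2)) • y = 0 := by linear_combination (norm := module) k1 - hhalf • y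
    have y0 := (smul_eq_zero.1 k1').resolve_left (mul_ne_zero h2 hη2')
    have w0 := (smul_eq_zero.1 k2).resolve_left hη2'
    exact ⟨p, by rw [e', y0, w0, add_zero, add_zero]⟩
  · have e := hT' u v
    rw [(orth' _ u hη1 hu).1, (orth' _ v h12 hv).1, (orth' _ v h12 hv).2, mul_comm v a, hu, hv,
      smul_mul_assoc, smul_mul_assoc, mul_comm v u, mul_comm _ a, orth _ _ u v hη2 hu hv] at e
    linear_combination (norm := module) e - hhalf • (u * v)
  -- Here the factor is `η`, so `uv - p a` is an `η`-eigenvector exactly when `(1 - η) p = -η (u,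
  -- v)`.
  · have e := hT' u v
    rw [(orth' _ u h12 hu).1, (orth' _ v h12 hv).1, (orth' _ v h12 hv).2, mul_comm v a, hu, hv,
      smul_mul_assoc, smul_mul_assoc, mul_comm v u, mul_comm _ a] at e
    have e' : a * (u * v) = η • (u * v) - (η * B u v) • a := by
      linear_combination (norm := module) e - hhalf • (u * v)
    have hp : (1 - η) * (-(η * B u v) / (1 - η)) = -(η * B u v) := by field_simp
    refine ⟨-(η * B u v) / (1 - η), u * v - (-(η * B u v) / (1 - η)) • a, by module, ?_⟩
    rw [mul_sub, mul_smul_comm, idem, e']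
    linear_combination (norm := module) -hp • a

end CubicIdentity

/-! ### Computable polynomials with integer coefficients -/

/-- Polynomials with integer coefficients in four variables, as lists of terms (an exponent vector
and a coefficient). -/
inductive IntPoly : Type
  | nil : IntPoly
  | cons : ℕ × ℕ × ℕ × ℕ → ℤ → IntPoly → IntPoly

namespace IntPoly

/-- Equality of exponent vectors. -/
def sameMono (m n : ℕ × ℕ × ℕ × ℕ) : Bool :=
  Nat.beq m.1 n.1 && (Nat.beq m.2.1 n.2.1 && (Nat.beq m.2.2.1 n.2.2.1 && Nat.beq m.2.2.2 n.2.2.2))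

theorem eq_of_sameMono {m n : ℕ × ℕ × ℕ × ℕ} (h : sameMono m n = true) : m = n := by
  simp only [sameMono, Bool.and_eq_true, Nat.beq_eq] at h
  exact Prod.ext h.1 (Prod.ext h.2.1 (Prod.ext h.2.2.1 h.2.2.2))

/-- Like terms are collected on addition, so that cancellation becomes visible in the coefficients
tested by `isZero`. Only the soundness of that test, `eval_eq_zero`, enters the proof. -/
def addTerm (m : ℕ × ℕ × ℕ × ℕ) (z : ℤ) : IntPoly → IntPoly
  | nil => cons m z nil
  | cons n w p => bif sameMono m n then cons n (w + z) p else cons n w (addTerm m z p)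

def add (p : IntPoly) : IntPoly → IntPoly
  | nil => p
  | cons m z q => addTerm m z (add p q)

def mulTerm (m : ℕ × ℕ × ℕ × ℕ) (z : ℤ) : IntPoly → IntPoly
  | nil => nil
  | cons n w p => cons (m.1 + n.1, m.2.1 + n.2.1, m.2.2.1 + n.2.2.1, m.2.2.2 + n.2.2.2) (z * w)
      (mulTerm m z p)

def mul (p : IntPoly) : IntPoly → IntPoly
  | nil => nil
  | cons m z q => add (mul p q) (mulTerm m z p)

def const (z : ℤ) : IntPoly := cons (0, 0, 0, 0) z nil

/-- All coefficients vanish. -/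
def isZero : IntPoly → Bool
  | nil => true
  | cons _ z p => z == 0 && isZero p

instance : Add IntPoly := ⟨add⟩
instance : Mul IntPoly := ⟨mul⟩
instance : Neg IntPoly := ⟨mulTerm (0, 0, 0, 0) (-1)⟩
instance : Sub IntPoly := ⟨fun p q => p + -q⟩
instance : Zero IntPoly := ⟨nil⟩
instance : One IntPoly := ⟨const 1⟩
instance (n : ℕ) [n.AtLeastTwo] : OfNat IntPoly n := ⟨const n⟩

section Eval

variable {F : Type*} [Field F] (v : F × F × F × F)

def evalMono (m : ℕ × ℕ × ℕ × ℕ) : F :=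
  v.1 ^ m.1 * v.2.1 ^ m.2.1 * v.2.2.1 ^ m.2.2.1 * v.2.2.2 ^ m.2.2.2

/-- The value of a polynomial at a point. -/
def eval : IntPoly → F
  | nil => 0
  | cons m z p => z * evalMono v m + eval p

theorem eval_addTerm (m : ℕ × ℕ × ℕ × ℕ) (z : ℤ) (p : IntPoly) :
    eval v (addTerm m z p) = z * evalMono v m + eval v p := by
  induction p with
  | nil => rfl
  | cons n w p ih =>
    rw [addTerm]
    cases h : sameMono m n
    · rw [cond_false, eval, eval, ih]
      ring
    · rw [cond_true, eq_of_sameMono h]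
      simp only [eval, Int.cast_add]
      ring

theorem eval_add (p q : IntPoly) : eval v (p + q) = eval v p + eval v q := by
  change eval v (add p q) = _
  induction q with
  | nil => simp [add, eval]
  | cons m z q ih =>
    rw [add, eval_addTerm, ih, eval]
    ring

theorem eval_mulTerm (m : ℕ × ℕ × ℕ × ℕ) (z : ℤ) (p : IntPoly) :
    eval v (mulTerm m z p) = z * evalMono v m * eval v p := by
  induction p with
  | nil => simp [mulTerm, eval]
  | cons n w p ih =>
    simp only [mulTerm, eval, ih, evalMono, pow_add, Int.cast_mul]
    ring

theorem eval_mul (p q : IntPoly) : eval v (p * q) = eval v p * eval v q := by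
  change eval v (mul p q) = _
  induction q with
  | nil => simp [mul, eval]
  | cons m z q ih =>
    have h : mul p (cons m z q) = mul p q + mulTerm m z p := rfl
    rw [h, eval_add, eval_mulTerm, ih, eval]
    ring

theorem eval_neg (p : IntPoly) : eval v (-p) = -eval v p := by
  change eval v (mulTerm _ _ p) = _
  rw [eval_mulTerm]
  simp [evalMono]

theorem eval_sub (p q : IntPoly) : eval v (p - q) = eval v p - eval v q := by
  change eval v (p + -q) = _
  rw [eval_add, eval_neg, sub_eq_add_neg]

theorem eval_zero : eval v 0 = 0 := rfl

theorem eval_one : eval v 1 = 1 := by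
  change eval v (const 1) = _
  simp [const, eval, evalMono]

theorem eval_ofNat (n : ℕ) [n.AtLeastTwo] : eval v ofNat(n) = ofNat(n) := by
  have h : eval v (const n) = n := by simp [const, eval, evalMono]
  exact h.trans (Nat.cast_ofNat (n := n))

theorem eval_eq_zero {p : IntPoly} (h : p.isZero = true) : eval v p = 0 := by
  induction p with
  | nil => rfl
  | cons n w p ih =>
    simp only [isZero, Bool.and_eq_true, beq_iff_eq] at h
    rw [eval, h.1, ih h.2]
    simp

end Eval

/-- The variables. -/
def x₁ : IntPoly := cons (1, 0, 0, 0) 1 nil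
def x₂ : IntPoly := cons (0, 1, 0, 0) 1 nil
def x₃ : IntPoly := cons (0, 0, 1, 0) 1 nil
def x₄ : IntPoly := cons (0, 0, 0, 1) 1 nil

section EvalVar

variable {F : Type*} [Field F] (v : F × F × F × F)

theorem eval_x₁ : eval v x₁ = v.1 := by simp [x₁, eval, evalMono]
theorem eval_x₂ : eval v x₂ = v.2.1 := by simp [x₂, eval, evalMono]
theorem eval_x₃ : eval v x₃ = v.2.2.1 := by simp [x₃, eval, evalMono]
theorem eval_x₄ : eval v x₄ = v.2.2.2 := by simp [x₄, eval, evalMono]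

end EvalVar

end IntPoly

/-! ### Structure constants -/

/-- An algebra with basis indexed by `Fin 8`, whose structure constants are polynomials, together
with a bilinear form and a linear form. Only the upper triangular parts are listed. -/
structure StructureData where
  mul : List (List (List IntPoly))
  form : List (List IntPoly)
  weight : List IntPoly
  eta : IntPoly

namespace StructureData

variable (d : StructureData)

/-- The entry of a list with a given index, and a default value beyond the end. -/
def entry {T : Type} (t : T) : List T → ℕ → T
  | [], _ => t
  | x :: _, 0 => x
  | _ :: l, n + 1 => entry t l n

/-- The coefficient of the product of the basis vectors `i`, `j` at the basis vector `m`. -/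
def coeff (i j m : Fin 8) : IntPoly :=
  -- Each listed row begins at the diagonal, so the product of `i ≤ j` stands at position `j - i`.
  entry 0 (entry [] (entry [] d.mul (min i.1 j.1)) (max i.1 j.1 - min i.1 j.1)) m.1

def formCoeff (i j : Fin 8) : IntPoly :=
  entry 0 (entry [] d.form (min i.1 j.1)) (max i.1 j.1 - min i.1 j.1)

def weightCoeff (i : Fin 8) : IntPoly := entry 0 d.weight i.1

def delta (k l : Fin 8) : IntPoly := if k = l then 1 else 0

def indices : List (Fin 8) := [0, 1, 2, 3, 4, 5, 6, 7]

/-- The defect of the cubic identity for the basis vectors `i`, `j`, `k` at the basis vector `l`. -/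
def cubicDefect (i j k l : Fin 8) : IntPoly :=
  indices.foldr (fun m r => (d.coeff i j m * d.coeff m k l + d.coeff j k m * d.coeff m i l +
    d.coeff k i m * d.coeff m j l) + r) 0 -
    ((1 + d.eta) * (d.weightCoeff i * d.coeff j k l + d.weightCoeff j * d.coeff k i l +
      d.weightCoeff k * d.coeff i j l) -
    d.eta * (d.formCoeff i j * delta k l + d.formCoeff j k * delta i l +
      d.formCoeff k i * delta j l))

/-- The defect of the associativity of the form with the basis vector `i`. -/
def assocDefect (i j k : Fin 8) : IntPoly :=
  indices.foldr (fun m r => (d.coeff i j m * d.formCoeff m k - d.coeff i k m * d.formCoeff j m) + r)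
    0

/-- The structure constants for `η = -1` in the basis
`2a, 2b, 2c, 4ab, 4bc, 4ac, 8a(bc), 8b(ac)`. -/
def negOne : StructureData :=
  let α := IntPoly.x₁
  let β := IntPoly.x₂
  let γ := IntPoly.x₃
  let ψ := IntPoly.x₄
  { mul := [
    [[2, 0, 0, 0, 0, 0, 0, 0],
     [0, 0, 0, 1, 0, 0, 0, 0],
     [0, 0, 0, 0, 0, 1, 0, 0],
     [4*α, 2, 0, -1, 0, 0, 0, 0],
     [0, 0, 0, 0, 0, 0, 1, 0],
     [4*γ, 0, 2, 0, 0, -1, 0, 0],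
     [8*ψ, 0, 0, 0, 2, 0, -1, 0],
     [2*β - 4*ψ, 2*γ, -6*α, -2*γ, -1, 6*α, 1, 1]],
    [[0, 2, 0, 0, 0, 0, 0, 0],
     [0, 0, 0, 0, 1, 0, 0, 0],
     [2, 4*α, 0, -1, 0, 0, 0, 0],
     [0, 4*β, 2, 0, -1, 0, 0, 0],
     [0, 0, 0, 0, 0, 0, 0, 1],
     [2*β, 2*γ - 4*ψ, -6*α, -2*β, 6*α, -1, 1, 1],
     [0, 8*ψ, 0, 0, 0, 2, 0, -1]],
    [[0, 0, 2, 0, 0, 0, 0, 0],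
     [4*β, 4*γ, 4*α, 0, 0, 0, -1, -1],
     [0, 2, 4*β, 0, -1, 0, 0, 0],
     [2, 0, 4*γ, 0, 0, -1, 0, 0],
     [6*β, -2*γ, 6*α - 4*ψ, -1, 6*γ, -2*β, 0, -1],
     [-2*β, 6*γ, 6*α - 4*ψ, -1, -2*γ, 6*β, -1, 0]],
    [[12*α - 2, 12*α - 2, 0, -4*α - 2, 0, 0, 0, 0],
     [6*β, -2*γ + 12*ψ, 6*α, -2*β, -2*α, -1, 0, -1],
     [-2*β + 12*ψ, 6*γ, 6*α, -2*γ, -1, -2*α, -1, 0],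
     [24*α*β - 4*β + 12*γ - 12*ψ, -4*β + 12*ψ, -2, -4*β - 4*ψ, 6*α + 1, -2, -2*α + 1, 0],
     [-4*γ + 12*ψ, 24*α*γ + 12*β - 4*γ - 12*ψ, -2, -4*γ - 4*ψ, -2, 6*α + 1, 0, -2*α + 1]],
    [[0, 12*β - 2, 12*β - 2, 0, -4*β - 2, 0, 0, 0],
     [2*β, 2*γ, -6*α + 12*ψ, -1, -2*γ, -2*β, 1, 1],
     [8*β*β - 4*β + 4, 0, 0, -6*β + 1, 8*ψ, -6*β + 1, 2*β + 1, 0],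
     [-2, 12*α + 24*β*γ - 4*γ - 12*ψ, -4*γ + 12*ψ, -2, -4*γ - 4*ψ, 6*β + 1, 0, -2*β + 1]],
    [[12*γ - 2, 0, 12*γ - 2, 0, 0, -4*γ - 2, 0, 0],
     [12*α + 24*β*γ - 4*β - 12*ψ, -2, -4*β + 12*ψ, -2, 6*γ + 1, -4*β - 4*ψ, -2*γ + 1, 0],
     [0, 8*γ*γ - 4*γ + 4, 0, -6*γ + 1, -6*γ + 1, 8*ψ, 0, 2*γ + 1]],
    [[72*α*β - 12*α - 8*β*β + 72*β*γ - 48*β*ψ + 4*β - 12*γ - 24*ψ - 4, -12*β + 2, -12*β + 2, -12*β + 2, 4*β + 24*ψ + 2, -12*β + 2, 4*β - 8*ψ + 2, 0],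
     [-12*α*β - 4*β*β - 28*β*γ + 24*β*ψ + 2*β + 12*γ + 12*ψ + 2, -12*α*γ - 28*β*γ + 12*β - 4*γ*γ + 24*γ*ψ + 2*γ + 12*ψ + 2, 36*α*α + 12*α*β + 12*α*γ - 72*α*ψ + 6*α - 12*ψ - 4, -6*α - 32*β*γ + 6*β + 6*γ + 12*ψ - 1, 24*α*γ - 6*α + 2*β + 6*γ - 12*ψ - 1, 24*α*β - 6*α + 6*β + 2*γ - 12*ψ - 1, -6*α - 2*β + 4*γ + 8*ψ - 2, -6*α + 4*β - 2*γ + 8*ψ - 2]],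
    [[-12*γ + 2, 72*α*γ - 12*α + 72*β*γ - 12*β - 8*γ*γ - 48*γ*ψ + 4*γ - 24*ψ - 4, -12*γ + 2, -12*γ + 2, -12*γ + 2, 4*γ + 24*ψ + 2, 0, 4*γ - 8*ψ + 2]]]
    -- Associativity reduces every value to `(a, b) = α`, `(b, c) = β`, `(a, c) = γ` and `(a, bc) =
    -- ψ`. For instance `(a, b(ac)) = (ab, ac) = (b, a(ac))`, and `a(ac)` is in the table.
    form := [
    [4, 4*α, 4*γ, 8*α, 8*ψ, 8*γ, 16*ψ, 16*α*γ + 8*β - 8*ψ],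
    [4, 4*β, 8*α, 8*β, 8*ψ, 16*α*β + 8*γ - 8*ψ, 16*ψ],
    [4, 8*ψ, 8*β, 8*γ, 8*α + 16*β*γ - 8*ψ, 8*α + 16*β*γ - 8*ψ],
    [16*α*α - 8*α + 8, 16*α*β + 8*γ - 8*ψ, 16*α*γ + 8*β - 8*ψ, -16*α*β + 32*α*ψ + 16*β - 8*γ + 8*ψ, -16*α*γ + 32*α*ψ - 8*β + 16*γ + 8*ψ],
    [16*β*β - 8*β + 8, 8*α + 16*β*γ - 8*ψ, 48*α*β - 8*α + 48*β*γ - 32*β*ψ - 8*γ - 16*ψ, -8*α - 16*β*γ + 32*β*ψ + 16*γ + 8*ψ],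
    [16*γ*γ - 8*γ + 8, -8*α - 16*β*γ + 16*β + 32*γ*ψ + 8*ψ, 48*α*γ - 8*α + 48*β*γ - 8*β - 32*γ*ψ - 16*ψ],
    [-48*α*β + 8*α + 32*β*β - 48*β*γ + 32*β*ψ - 16*β + 8*γ + 64*ψ*ψ + 16*ψ + 16, 48*α*α + 64*α*β*γ - 48*α*ψ - 16*α - 16*β*β + 48*β*γ + 16*β*ψ + 8*β - 16*γ*γ + 16*γ*ψ + 8*γ - 32*ψ*ψ - 8*ψ - 8],
    [-48*α*γ + 8*α - 48*β*γ + 8*β + 32*γ*γ + 32*γ*ψ - 16*γ + 64*ψ*ψ + 16*ψ + 16]]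
    -- All weights default to zero: they occur only with the factor `1 + η = 0`.
    weight := []
    eta := -1 }

/-- The structure constants for `η ≠ -1` in the basis
`2a, 2b, 2c, 4ab, 4bc, 4ac, 8a(bc), 8b(ac)`. -/
def generic : StructureData :=
  let η := IntPoly.x₁
  { mul := [
    [[2, 0, 0, 0, 0, 0, 0, 0],
     [0, 0, 0, 1, 0, 0, 0, 0],
     [0, 0, 0, 0, 0, 1, 0, 0],
     [-2*η + 2, -2*η, 0, 2*η + 1, 0, 0, 0, 0],
     [0, 0, 0, 0, 0, 0, 1, 0],
     [-2*η + 2, 0, -2*η, 0, 0, 2*η + 1, 0, 0],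
     [-4*η + 4, 0, 0, 0, -2*η, 0, 2*η + 1, 0],
     [-4*η*η + 2, -2*η, -4*η*η + 2*η, 2*η, -1, 4*η*η - 2*η, 1, 1]],
    [[0, 2, 0, 0, 0, 0, 0, 0],
     [0, 0, 0, 0, 1, 0, 0, 0],
     [-2*η, -2*η + 2, 0, 2*η + 1, 0, 0, 0, 0],
     [0, -2*η + 2, -2*η, 0, 2*η + 1, 0, 0, 0],
     [0, 0, 0, 0, 0, 0, 0, 1],
     [-2*η, -4*η*η + 2, -4*η*η + 2*η, 2*η, 4*η*η - 2*η, -1, 1, 1],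
     [0, -4*η + 4, 0, 0, 0, -2*η, 0, 2*η + 1]],
    [[0, 0, 2, 0, 0, 0, 0, 0],
     [-4*η, -4*η, -4*η, 2*η + 2, 2*η + 2, 2*η + 2, -1, -1],
     [0, -2*η, -2*η + 2, 0, 2*η + 1, 0, 0, 0],
     [-2*η, 0, -2*η + 2, 0, 0, 2*η + 1, 0, 0],
     [-6*η, -4*η*η - 2*η, -4*η*η - 4*η + 2, 2*η + 1, 4*η*η + 2, 4*η + 2, 0, -1],
     [-4*η*η - 2*η, -6*η, -4*η*η - 4*η + 2, 2*η + 1, 4*η + 2, 4*η*η + 2, -1, 0]],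
    [[-8*η + 2, -8*η + 2, 0, 8*η + 2, 0, 0, 0, 0],
     [-6*η, -8*η + 2, -6*η, 4*η + 2, 4*η + 2, 2*η + 1, 0, -1],
     [-8*η + 2, -6*η, -6*η, 4*η + 2, 2*η + 1, 4*η + 2, -1, 0],
     [-16*η + 4, -4*η*η - 10*η + 2, -4*η*η - 2*η, 10*η + 2, 4*η*η - 2*η + 1, 2*η, 2*η + 1, 0],
     [-4*η*η - 10*η + 2, -16*η + 4, -4*η*η - 2*η, 10*η + 2, 2*η, 4*η*η - 2*η + 1, 0, 2*η + 1]],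
    [[0, -8*η + 2, -8*η + 2, 0, 8*η + 2, 0, 0, 0],
     [-2*η, -2*η, -4*η + 2, -1, 2*η, 2*η, 1, 1],
     [-8*η, -8*η*η - 6*η + 2, -8*η*η - 6*η + 2, 4*η - 1, 8*η*η + 2*η + 2, 4*η - 1, 3, 0],
     [-4*η*η - 2*η, -16*η + 4, -4*η*η - 10*η + 2, 2*η, 10*η + 2, 4*η*η - 2*η + 1, 0, 2*η + 1]],
    [[-8*η + 2, 0, -8*η + 2, 0, 0, 8*η + 2, 0, 0],
     [-16*η + 4, -4*η*η - 2*η, -4*η*η - 10*η + 2, 2*η, 4*η*η - 2*η + 1, 10*η + 2, 2*η + 1, 0],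
     [-8*η*η - 6*η + 2, -8*η, -8*η*η - 6*η + 2, 4*η - 1, 4*η - 1, 8*η*η + 2*η + 2, 0, 3]],
    [[-32*η + 8, -16*η*η - 4*η + 2, -16*η*η - 4*η + 2, 8*η - 2, 16*η*η - 12*η + 2, 8*η - 2, 8*η + 6, 0],
     [-12*η*η - 16*η + 4, -12*η*η - 16*η + 4, -24*η*η + 2, 12*η - 3, 12*η*η - 2*η - 1, 12*η*η - 2*η - 1, 2*η + 4, 2*η + 4]],
    [[-16*η*η - 4*η + 2, -32*η + 8, -16*η*η - 4*η + 2, 8*η - 2, 8*η - 2, 16*η*η - 12*η + 2, 0, 8*η + 6]]]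
    -- Each entry is the product of two of the weights below.
    form := [
    [4, 4, 4, 8, 8, 8, 16, 16],
    [4, 4, 8, 8, 8, 16, 16],
    [4, 8, 8, 8, 16, 16],
    [16, 16, 16, 32, 32],
    [16, 16, 32, 32],
    [16, 32, 32],
    [64, 64],
    [64]]
    weight := [2, 2, 2, 4, 4, 4, 8, 8]
    eta := η }

/-- This and the next three results are the only large computations. Symmetry allows sorted indices,
and one index below `3` is enough because only the three generators have to be shown to be axes. -/
theorem negOne_assocDefect : ∀ i j k : Fin 8, i.1 < 3 → j ≤ k →
    (negOne.assocDefect i j k).isZero = true := by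
  decide +kernel

theorem negOne_cubicDefect : ∀ i j k l : Fin 8, i.1 < 3 → i ≤ j → j ≤ k →
    (negOne.cubicDefect i j k l).isZero = true := by
  decide +kernel

theorem generic_assocDefect : ∀ i j k : Fin 8, i.1 < 3 → j ≤ k →
    (generic.assocDefect i j k).isZero = true := by
  decide +kernel

theorem generic_cubicDefect : ∀ i j k l : Fin 8, i.1 < 3 → i ≤ j → j ≤ k →
    (generic.cubicDefect i j k l).isZero = true := by
  decide +kernel

end StructureData

/-! ### Tables satisfying the cubic identity -/

section CubicTable

variable {F : Type*} [Field F]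

/-- Structure constants `C`, a symmetric form `b` and weights `w` on eight basis vectors, the first
three of which satisfy the cubic identity with all other ones, and which multiply like
`2a, 2b, 2c, 4ab, 4bc, 4ac, 8a(bc), 8b(ac)`. -/
structure IsCubicTable (η : F) (C : Fin 8 → Fin 8 → Fin 8 → F) (b : Fin 8 → Fin 8 → F)
    (w : Fin 8 → F) : Prop where
  comm : ∀ i j, C i j = C j i
  form_symm : ∀ i j, b i j = b j i
  cubic : ∀ i j k l, i.1 < 3 → i ≤ j → j ≤ k →
    ∑ m, (C i j m * C m k l + C j k m * C m i l + C k i m * C m j l) =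
      (1 + η) * (w i * C j k l + w j * C k i l + w k * C i j l) -
      η * (b i j * (if k = l then 1 else 0) + b j k * (if i = l then 1 else 0) +
        b k i * (if j = l then 1 else 0))
  assoc : ∀ i j k, i.1 < 3 → ∑ m, C i j m * b m k = ∑ m, C i k m * b j m
  idem : ∀ i, i.1 < 3 → C i i = Pi.single i 2
  row01 : C 0 1 = Pi.single 3 1
  row12 : C 1 2 = Pi.single 4 1
  row02 : C 0 2 = Pi.single 5 1
  row04 : C 0 4 = Pi.single 6 1
  row15 : C 1 5 = Pi.single 7 1
  -- Of these products only the coefficients at `a(bc)` and `b(ac)` matter: they tell which unknown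
  -- defects survive when a product is expanded.
  tail03 : C 0 3 6 = 0 ∧ C 0 3 7 = 0
  tail13 : C 1 3 6 = 0 ∧ C 1 3 7 = 0
  tail14 : C 1 4 6 = 0 ∧ C 1 4 7 = 0
  tail24 : C 2 4 6 = 0 ∧ C 2 4 7 = 0
  tail05 : C 0 5 6 = 0 ∧ C 0 5 7 = 0
  tail25 : C 2 5 6 = 0 ∧ C 2 5 7 = 0
  tail23 : C 2 3 6 = -1 ∧ C 2 3 7 = -1
  tail07 : C 0 7 6 = 1 ∧ C 0 7 7 = 1
  form_diag : ∀ i, i.1 < 3 → b i i = 4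
  weight : ∀ i j, i.1 < 3 → (1 + η) * (2 * w j) = (1 + η) * b i j

theorem sum_single_smul {M : Type*} [AddCommGroup M] [Module F M] (k : Fin 8) (x : F)
    (f : Fin 8 → M) : ∑ m, (Pi.single k x : Fin 8 → F) m • f m = x • f k := by
  rw [Finset.sum_eq_single k]
  · rw [Pi.single_eq_same]
  · intro m _ hm
    rw [Pi.single_eq_of_ne hm, zero_smul]
  · simp

variable {M : Type*} [AddCommGroup M] [Module F M] {η : F} {C : Fin 8 → Fin 8 → Fin 8 → F}
  {b : Fin 8 → Fin 8 → F} {w : Fin 8 → F}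

/-- If symmetric families `D` (of vectors) and `β` (of scalars) measure how far an algebra is from
having a given table, then they vanish once they vanish on the products defining the basis. -/
theorem IsCubicTable.defects_eq_zero (h2 : (2 : F) ≠ 0) (h : IsCubicTable η C b w)
    {D : Fin 8 → Fin 8 → M} {β : Fin 8 → Fin 8 → F} (hD : ∀ i j, D i j = D j i)
    (hβ : ∀ i j, β i j = β j i)
    (T : ∀ i j k, i.1 < 3 → i ≤ j → j ≤ k → D i j = 0 → D j k = 0 → D i k = 0 → β i j = 0 →
      β j k = 0 → β i k = 0 →
      ∑ m, C i j m • D m k + ∑ m, C j k m • D m i + ∑ m, C i k m • D m j = 0)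
    (S : ∀ i j k, i.1 < 3 → D i j = 0 → D i k = 0 →
      ∑ m, C i j m • β m k = ∑ m, C i k m • β j m)
    (Ddiag : ∀ i, i.1 < 3 → D i i = 0) (d01 : D 0 1 = 0) (d12 : D 1 2 = 0) (d02 : D 0 2 = 0)
    (d04 : D 0 4 = 0) (d15 : D 1 5 = 0) (βdiag : ∀ i, i.1 < 3 → β i i = 0) (b01 : β 0 1 = 0)
    (b12 : β 1 2 = 0) (b02 : β 0 2 = 0) (b04 : β 0 4 = 0) (i j : Fin 8) : D i j = 0 := by
  have cancel : ∀ u : M, (2 : F) • u = 0 → u = 0 := fun u hu => (smul_eq_zero.1 hu).resolve_left h2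
  have cancel' : ∀ u : M, u + u = 0 → u = 0 := fun u hu => cancel u (by rw [two_smul, hu])
  have d00 : D 0 0 = 0 := Ddiag 0 (by decide)
  have d11 : D 1 1 = 0 := Ddiag 1 (by decide)
  have d22 : D 2 2 = 0 := Ddiag 2 (by decide)
  have b00 : β 0 0 = 0 := βdiag 0 (by decide)
  have b11 : β 1 1 = 0 := βdiag 1 (by decide)
  have b22 : β 2 2 = 0 := βdiag 2 (by decide)
  have r00 : C 0 0 = Pi.single 0 2 := h.idem 0 (by decide)
  have r11 : C 1 1 = Pi.single 1 2 := h.idem 1 (by decide)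
  have r22 : C 2 2 = Pi.single 2 2 := h.idem 2 (by decide)
  obtain ⟨r01, r12, r02, r04, r15⟩ : C 0 1 = Pi.single 3 1 ∧ C 1 2 = Pi.single 4 1 ∧
    C 0 2 = Pi.single 5 1 ∧ C 0 4 = Pi.single 6 1 ∧ C 1 5 = Pi.single 7 1 :=
    ⟨h.row01, h.row12, h.row02, h.row04, h.row15⟩
  have r10 := (h.comm 1 0).trans r01
  have r21 := (h.comm 2 1).trans r12
  have r20 := (h.comm 2 0).trans r02
  -- the form on products of two axes
  have b03 : β 0 3 = 0 := by
    have e := S 0 0 1 (by decide) d00 d01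
    simpa only [r00, r01, sum_single_smul, b01, smul_zero, one_smul] using e.symm
  have b13 : β 1 3 = 0 := by
    have e := S 1 1 0 (by decide) d11 (hD 0 1 ▸ d01)
    simpa only [r11, r10, sum_single_smul, hβ 1 0, b01, smul_zero, one_smul] using e.symm
  have b05 : β 0 5 = 0 := by
    have e := S 0 0 2 (by decide) d00 d02
    simpa only [r00, r02, sum_single_smul, b02, smul_zero, one_smul] using e.symm
  have b25 : β 2 5 = 0 := by
    have e := S 2 2 0 (by decide) d22 (hD 0 2 ▸ d02)
    simpa only [r22, r20, sum_single_smul, hβ 2 0, b02, smul_zero, one_smul] using e.symm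
  have b14 : β 1 4 = 0 := by
    have e := S 1 1 2 (by decide) d11 d12
    simpa only [r11, r12, sum_single_smul, b12, smul_zero, one_smul] using e.symm
  have b24 : β 2 4 = 0 := by
    have e := S 2 2 1 (by decide) d22 (hD 1 2 ▸ d12)
    simpa only [r22, r21, sum_single_smul, hβ 2 1, b12, smul_zero, one_smul] using e.symm
  -- This is `(ab, c) = (a, bc)`.
  have b23 : β 2 3 = 0 := by
    have e := S 1 0 2 (by decide) (hD 0 1 ▸ d01) d12
    simpa only [r10, r12, sum_single_smul, b04, hβ 3 2, smul_zero, one_smul] using e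
  have b15 : β 1 5 = 0 := by
    have e := S 0 1 2 (by decide) d01 d02
    simpa only [r01, r02, sum_single_smul, b23, hβ 3 2, smul_zero, one_smul] using e.symm
  -- products with axes
  have d03 : D 0 3 = 0 := by
    have e := T 0 0 1 (by decide) (by decide) (by decide) d00 d01 d01 b00 b01 b01
    simp only [r00, r01, sum_single_smul, d01, hD 3 0, smul_zero, one_smul, zero_add] at e
    exact cancel' _ e
  have d05 : D 0 5 = 0 := by
    have e := T 0 0 2 (by decide) (by decide) (by decide) d00 d02 d02 b00 b02 b02
    simp only [r00, r02, sum_single_smul, d02, hD 5 0, smul_zero, one_smul, zero_add] at e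
    exact cancel' _ e
  have d13 : D 1 3 = 0 := by
    have e := T 0 1 1 (by decide) (by decide) (by decide) d01 d11 d01 b01 b11 b01
    simp only [r11, r01, sum_single_smul, d01, hD 1 0, hD 3 1, smul_zero, one_smul,
      add_zero] at e
    exact cancel' _ e
  have d14 : D 1 4 = 0 := by
    have e := T 1 1 2 (by decide) (by decide) (by decide) d11 d12 d12 b11 b12 b12
    simp only [r11, r12, sum_single_smul, d12, hD 4 1, smul_zero, one_smul, zero_add] at e
    exact cancel' _ e
  have d24 : D 2 4 = 0 := by
    have e := T 1 2 2 (by decide) (by decide) (by decide) d12 d22 d12 b12 b22 b12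
    simp only [r22, r12, sum_single_smul, d12, hD 2 1, hD 4 2, smul_zero, one_smul,
      add_zero] at e
    exact cancel' _ e
  have d25 : D 2 5 = 0 := by
    have e := T 0 2 2 (by decide) (by decide) (by decide) d02 d22 d02 b02 b22 b02
    simp only [r22, r02, sum_single_smul, d02, hD 2 0, hD 5 2, smul_zero, one_smul,
      add_zero] at e
    exact cancel' _ e
  have d23 : D 2 3 = 0 := by
    have e := T 0 1 2 (by decide) (by decide) (by decide) d01 d12 d02 b01 b12 b02
    simpa only [r01, r12, r02, sum_single_smul, d04, d15, hD 3 2, hD 4 0, hD 5 1, smul_zero,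
      one_smul, add_zero] using e
  have d06 : D 0 6 = 0 := by
    have e := T 0 0 4 (by decide) (by decide) (by decide) d00 d04 d04 b00 b04 b04
    simp only [r00, r04, sum_single_smul, d04, hD 6 0, smul_zero, one_smul, zero_add] at e
    exact cancel' _ e
  have d17 : D 1 7 = 0 := by
    have e := T 1 1 5 (by decide) (by decide) (by decide) d11 d15 d15 b11 b15 b15
    simp only [r11, r15, sum_single_smul, d15, hD 7 1, smul_zero, one_smul, zero_add] at e
    exact cancel' _ e
  -- The triples `a, b, bc` and `b, c, ab` give `D 3 4 + D 1 6 = 0` and `D 3 4 - D 1 6 = 0`. The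
  -- next step eliminates `D 3 5` in the same way.
  have d16 : D 1 6 = 0 := by
    have e := T 0 1 4 (by decide) (by decide) (by decide) d01 d14 d04 b01 b14 b04
    have e' := T 1 2 3 (by decide) (by decide) (by decide) d12 d23 d13 b12 b23 b13
    simp only [r01, r12, r04, sum_single_smul] at e e'
    simp only [Fin.sum_univ_eight, h.tail14, h.tail23, h.tail13,
      d00, d01, d02, d03, d04, d05, d11, d12, d13, d14, d15, d17, d22, d23, d24, d25, hD 1 0,
      hD 2 0, hD 3 0, hD 4 0, hD 5 0, hD 6 1, hD 2 1, hD 3 1, hD 4 1, hD 5 1, hD 7 1, hD 3 2,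
      hD 4 2, hD 5 2, hD 4 3, smul_zero, zero_smul, one_smul, neg_smul, add_zero, zero_add] at e e'
    exact cancel' _ (by linear_combination (norm := module) e - e')
  have d07 : D 0 7 = 0 := by
    have e := T 0 2 3 (by decide) (by decide) (by decide) d02 d23 d03 b02 b23 b03
    have e' := T 0 1 5 (by decide) (by decide) (by decide) d01 d15 d05 b01 b15 b05
    simp only [r01, r02, r15, sum_single_smul] at e e'
    simp only [Fin.sum_univ_eight, h.tail05, h.tail23, h.tail03,
      d00, d01, d02, d03, d04, d05, d06, d11, d12, d13, d14, d15, d22, d23, d24, d25, hD 1 0,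
      hD 2 0, hD 3 0, hD 4 0, hD 5 0, hD 6 0, hD 7 0, hD 2 1, hD 3 1, hD 4 1, hD 5 1, hD 3 2,
      hD 4 2, hD 5 2, hD 5 3, smul_zero, zero_smul, one_smul, neg_smul, add_zero, zero_add] at e e'
    exact cancel' _ (by linear_combination (norm := module) e' - e)
  have d45 : D 4 5 = 0 ∧ D 2 6 = 0 ∧ D 2 7 = 0 := by
    -- Three equations for three unknowns: `D 4 5 + D 2 6 = 0`, `D 4 5 + D 2 7 = 0` and `2 (D 2 6 +
    -- D 2 7) = 0`, whence `4 D 4 5 = 0`.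
    have e := T 0 2 4 (by decide) (by decide) (by decide) d02 d24 d04 b02 b24 b04
    have e' := T 1 2 5 (by decide) (by decide) (by decide) d12 d25 d15 b12 b25 b15
    have e'' := T 2 2 3 (by decide) (by decide) (by decide) d22 d23 d23 b22 b23 b23
    simp only [r12, r02, r22, r04, r15, sum_single_smul] at e e' e''
    simp only [Fin.sum_univ_eight, h.tail24, h.tail23,
      h.tail25, d00, d01, d02, d03, d04, d05, d06, d07, d11, d12, d13, d14, d15, d16, d17, d22,
      d23, d24, d25, hD 1 0, hD 2 0, hD 3 0, hD 4 0, hD 5 0, hD 6 0, hD 7 0, hD 2 1, hD 3 1,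
      hD 4 1, hD 5 1, hD 6 1, hD 7 1, hD 3 2, hD 4 2, hD 5 2, hD 6 2, hD 7 2, hD 5 4, smul_zero,
      one_smul, neg_smul, add_zero, zero_add] at e e' e''
    have e4 : D 4 5 = 0 := cancel _ (cancel _
      (by linear_combination (norm := module) (2 : F) • e + (2 : F) • e' + e''))
    rw [e4, zero_add] at e e'
    exact ⟨e4, e, e'⟩
  obtain ⟨d45, d26, d27⟩ := d45
  have z0 : ∀ j, D 0 j = 0 := by intro j; fin_cases j <;> assumption
  have z1 : ∀ j, D 1 j = 0 := by
    intro j; fin_cases j <;> first | assumption | exact (hD _ _).trans (by assumption)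
  have z2 : ∀ j, D 2 j = 0 := by
    intro j; fin_cases j <;> first | assumption | exact (hD _ _).trans (by assumption)
  -- the remaining values of the form
  have b06 : β 0 6 = 0 := by
    have e := S 0 0 4 (by decide) d00 d04
    simpa only [r00, r04, sum_single_smul, b04, smul_zero, one_smul] using e.symm
  have b17 : β 1 7 = 0 := by
    have e := S 1 1 5 (by decide) d11 d15
    simpa only [r11, r15, sum_single_smul, b15, smul_zero, one_smul] using e.symm
  have b34 : β 3 4 = 0 := by
    have e := S 1 0 4 (by decide) (z1 _) (z1 _)
    rw [r10, sum_single_smul] at e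
    simpa only [Fin.sum_univ_eight, h.tail14, b00, b01, b02, b03, b04, b05,
      b06, smul_zero, zero_smul, one_smul, add_zero] using e
  have b16 : β 1 6 = 0 := by
    have e := S 0 1 4 (by decide) (z0 _) (z0 _)
    simpa only [r01, r04, sum_single_smul, b34, smul_zero, one_smul] using e.symm
  have b35 : β 3 5 = 0 := by
    have e := S 0 1 5 (by decide) (z0 _) (z0 _)
    rw [r01, sum_single_smul] at e
    simpa only [Fin.sum_univ_eight, h.tail05, hβ 1 0, b01, b11, b12, b13, b14,
      b15, b16, smul_zero, zero_smul, one_smul, add_zero] using e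
  have b07 : β 0 7 = 0 := by
    have e := S 1 0 5 (by decide) (z1 _) (z1 _)
    simpa only [r10, r15, sum_single_smul, b35, smul_zero, one_smul] using e.symm
  have b45 : β 4 5 = 0 := by
    have e := S 2 1 5 (by decide) (z2 _) (z2 _)
    rw [r21, sum_single_smul] at e
    simpa only [Fin.sum_univ_eight, h.tail25, hβ 1 0, b01, b11, b12, b13, b14,
      b15, b16, smul_zero, zero_smul, one_smul, add_zero] using e
  have b26 : β 2 6 = 0 := by
    have e := S 0 2 4 (by decide) (z0 _) (z0 _)
    simpa only [r02, r04, sum_single_smul, hβ 5 4, b45, smul_zero, one_smul] using e.symm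
  have b27 : β 2 7 = 0 := by
    have e := S 1 2 5 (by decide) (z1 _) (z1 _)
    simpa only [r12, r15, sum_single_smul, b45, smul_zero, one_smul] using e.symm
  have y1 : ∀ j, β 1 j = 0 := by
    intro j; fin_cases j <;> first | assumption | exact (hβ _ _).trans (by assumption)
  have y2 : ∀ j, β 2 j = 0 := by
    intro j; fin_cases j <;> first | assumption | exact (hβ _ _).trans (by assumption)
  have y0 : ∀ j, β 0 j = 0 := by intro j; fin_cases j <;> assumption
  -- Each remaining basis vector is a generator times an earlier one; associativity moves the
  -- generator to the other argument and leaves an earlier row of `β`.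
  have y3 : ∀ j, β 3 j = 0 := by
    intro j
    have e := S 0 1 j (by decide) (z0 _) (z0 _)
    simpa only [r01, sum_single_smul, y1, smul_zero, Finset.sum_const_zero, one_smul] using e
  have y4 : ∀ j, β 4 j = 0 := by
    intro j
    have e := S 1 2 j (by decide) (z1 _) (z1 _)
    simpa only [r12, sum_single_smul, y2, smul_zero, Finset.sum_const_zero, one_smul] using e
  have y5 : ∀ j, β 5 j = 0 := by
    intro j
    have e := S 0 2 j (by decide) (z0 _) (z0 _)
    simpa only [r02, sum_single_smul, y2, smul_zero, Finset.sum_const_zero, one_smul] using e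
  have y6 : ∀ j, β 6 j = 0 := by
    intro j
    have e := S 0 4 j (by decide) (z0 _) (z0 _)
    simpa only [r04, sum_single_smul, y4, smul_zero, Finset.sum_const_zero, one_smul] using e
  have y7 : ∀ j, β 7 j = 0 := by
    intro j
    have e := S 1 5 j (by decide) (z1 _) (z1 _)
    simpa only [r15, sum_single_smul, y5, smul_zero, Finset.sum_const_zero, one_smul] using e
  have y : ∀ i j, β i j = 0 := by
    intro i j
    fin_cases i
    exacts [y0 j, y1 j, y2 j, y3 j, y4 j, y5 j, y6 j, y7 j]
  -- the remaining products
  have z0' : ∀ j, D j 0 = 0 := fun j => (hD _ _).trans (z0 j)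
  have z1' : ∀ j, D j 1 = 0 := fun j => (hD _ _).trans (z1 j)
  have z2' : ∀ j, D j 2 = 0 := fun j => (hD _ _).trans (z2 j)
  -- With the row of the generator `i` known to vanish, the identity says that multiplication by it
  -- can be moved across `D` at the cost of a sign.
  have T' : ∀ i j k, i.1 < 3 → i ≤ j → j ≤ k → (∀ m, D i m = 0) → D j k = 0 →
      ∑ m, C i j m • D m k + ∑ m, C i k m • D m j = 0 := by
    intro i j k hi hij hjk hz e
    have z' : ∀ m, D m i = 0 := fun m => (hD _ _).trans (hz m)
    simpa only [z', smul_zero, Finset.sum_const_zero, add_zero] using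
      T i j k hi hij hjk (hz _) e (hz _) (y _ _) (y _ _) (y _ _)
  have e1 : ∀ k, 1 ≤ k → D 3 k = 0 := by
    intro k hk
    have e := T' 0 1 k (by decide) (by decide) hk z0 (z1 k)
    simpa only [r01, sum_single_smul, z1', smul_zero, Finset.sum_const_zero, add_zero, one_smul]
      using e
  have d33 : D 3 3 = 0 := e1 3 (by decide)
  have z3 : ∀ j, D 3 j = 0 := by
    intro j
    by_cases hj : 1 ≤ j
    · exact e1 j hj
    · obtain rfl : j = 0 := by omega
      exact z0' 3
  have d44 : D 4 4 = 0 := by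
    have e := T' 1 2 4 (by decide) (by decide) (by decide) z1 d24
    simpa only [r12, sum_single_smul, z2', smul_zero, Finset.sum_const_zero, add_zero, one_smul]
      using e
  have d55 : D 5 5 = 0 := by
    have e := T' 0 2 5 (by decide) (by decide) (by decide) z0 d25
    simpa only [r02, sum_single_smul, z2', smul_zero, Finset.sum_const_zero, add_zero, one_smul]
      using e
  have d46 : D 4 6 = 0 := by
    have e := T' 0 4 4 (by decide) (by decide) (by decide) z0 d44
    simp only [r04, sum_single_smul, one_smul, hD 6 4] at e
    exact cancel' _ e
  have d57 : D 5 7 = 0 := by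
    have e := T' 1 5 5 (by decide) (by decide) (by decide) z1 d55
    simp only [r15, sum_single_smul, one_smul, hD 7 5] at e
    exact cancel' _ e
  -- In `c(ab)` both `a(bc)` and `b(ac)` have coefficient `-1`, so the triple `c, ab, bc` gives `D 4
  -- 6 + D 4 7 = 0`; likewise for `D 5 6` below.
  have d47 : D 4 7 = 0 := by
    have e := T' 2 3 4 (by decide) (by decide) (by decide) z2 (z3 4)
    simpa only [Fin.sum_univ_eight, h.tail23, hD _ 3, z3, z0, z1, z2, z3, d44, hD 5 4, d45, hD 6 4,
      d46, hD 7 4, smul_zero, neg_smul, one_smul, zero_add, add_zero, neg_eq_zero] using e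
  have d56 : D 5 6 = 0 := by
    have e := T' 2 3 5 (by decide) (by decide) (by decide) z2 (z3 5)
    simpa only [Fin.sum_univ_eight, h.tail23, hD _ 3, z3, z0, z1, z2, z3, d45, d55, hD 6 5, hD 7 5,
      d57, smul_zero, neg_smul, one_smul, zero_add, add_zero, neg_eq_zero] using e
  have z4 : ∀ j, D 4 j = 0 := by
    intro j
    fin_cases j
    exacts [z0' 4, z1' 4, z2' 4, (hD _ _).trans (z3 4), d44, d45, d46, d47]
  have z5 : ∀ j, D 5 j = 0 := by
    intro j
    fin_cases j
    exacts [z0' 5, z1' 5, z2' 5, (hD _ _).trans (z3 5), (hD _ _).trans (z4 5), d55, d56, d57]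
  have z4' : ∀ j, D j 4 = 0 := fun j => (hD _ _).trans (z4 j)
  have z5' : ∀ j, D j 5 = 0 := fun j => (hD _ _).trans (z5 j)
  have d66 : D 6 6 = 0 := by
    have e := T' 0 4 6 (by decide) (by decide) (by decide) z0 d46
    simpa only [r04, sum_single_smul, z4', smul_zero, Finset.sum_const_zero, add_zero, one_smul]
      using e
  have d77 : D 7 7 = 0 := by
    have e := T' 1 5 7 (by decide) (by decide) (by decide) z1 d57
    simpa only [r15, sum_single_smul, z5', smul_zero, Finset.sum_const_zero, add_zero, one_smul]
      using e
  -- The product of `a` and `b(ac)` contains `a(bc)` with coefficient `1`, so the triple `a, b(ac),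
  -- b(ac)` yields `2 D 6 7 = 0`.
  have d67 : D 6 7 = 0 := by
    have e := T' 0 7 7 (by decide) (by decide) (by decide) z0 d77
    simp only [Fin.sum_univ_eight, h.tail07, z0, z1, z2, z3, z4, z5, d77, smul_zero, one_smul,
      zero_add, add_zero] at e
    exact cancel' _ e
  have z6 : ∀ j, D 6 j = 0 := by
    intro j
    fin_cases j
    exacts [z0' 6, z1' 6, z2' 6, (hD _ _).trans (z3 6), z4' 6, z5' 6, d66, d67]
  have z7 : ∀ j, D 7 j = 0 := by
    intro j
    fin_cases j
    exacts [z0' 7, z1' 7, z2' 7, (hD _ _).trans (z3 7), z4' 7, z5' 7, (hD _ _).trans d67, d77]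
  fin_cases i
  exacts [z0 j, z1 j, z2 j, z3 j, z4 j, z5 j, z6 j, z7 j]

end CubicTable

/-! ### Algebras with a cubic table -/

section CubicTableAlgebra

variable {F A : Type*} [Field F] [NonUnitalNonAssocCommRing A] [Module F A]
  [IsScalarTower F A A] [SMulCommClass F A A] {η : F} {C : Fin 8 → Fin 8 → Fin 8 → F}
  {b : Fin 8 → Fin 8 → F} {w : Fin 8 → F}

/-- The coordinate identity contracted with an arbitrary family `S`. It serves both for a basis and
for eight vectors that may be linearly dependent. -/
theorem IsCubicTable.sum_cubic (h : IsCubicTable η C b w) {M : Type*} [AddCommGroup M] [Module F M]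
    (S : Fin 8 → M) {i j k : Fin 8} (hi : i.1 < 3) (hij : i ≤ j) (hjk : j ≤ k) :
    ∑ l, (∑ m, C i j m * C m k l) • S l + ∑ l, (∑ m, C j k m * C m i l) • S l +
      ∑ l, (∑ m, C i k m * C m j l) • S l =
      (1 + η) • (w i • ∑ m, C j k m • S m + w j • ∑ m, C i k m • S m + w k • ∑ m, C i j m • S m) -
        η • (b i j • S k + b j k • S i + b i k • S j) := by
  have c : ∀ l, (∑ m, C i j m * C m k l + ∑ m, C j k m * C m i l + ∑ m, C i k m * C m j l) • S l =
      ((1 + η) * (w i * C j k l + w j * C i k l + w k * C i j l) -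
        η * (b i j * (if k = l then 1 else 0) + b j k * (if i = l then 1 else 0) +
          b i k * (if j = l then 1 else 0))) • S l := by
    intro l
    have := h.cubic i j k l hi hij hjk
    rw [h.comm k i, h.form_symm k i, Finset.sum_add_distrib, Finset.sum_add_distrib] at this
    rw [this]
  have hδ : ∀ (x : F) (k : Fin 8), ∑ l, (x * if k = l then 1 else 0) • S l = x • S k := by
    intro x k
    simp
  rw [← Finset.sum_add_distrib, ← Finset.sum_add_distrib]
  simp only [← add_smul, c]
  simp only [sub_smul, mul_smul, Finset.sum_sub_distrib, ← Finset.smul_sum]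
  simp only [add_smul _ _ (S _), Finset.sum_add_distrib, hδ]
  simp only [mul_smul, ← Finset.smul_sum]

/-- In an algebra satisfying the cubic identity, the vectors
`2a, 2b, 2c, 4ab, 4bc, 4ac, 8a(bc), 8b(ac)` multiply according to the table which has the same
values of the form on the generators. -/
theorem IsCubicTable.mul_eq (h2 : (2 : F) ≠ 0) (h : IsCubicTable η C b w)
    {B : LinearMap.BilinForm F A} {l : A → F} (hsymm : ∀ u v, B u v = B v u)
    (hB : ∀ u v w, B (u * v) w = B u (v * w))
    (hT : ∀ x y z, CubicIdentity η (fun u v => B u v) l x y z) {S : Fin 8 → A}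
    (hl : ∀ i, (1 + η) * l (S i) = (1 + η) * w i) (idem : ∀ i, i.1 < 3 → S i * S i = (2 : F) • S i)
    (s01 : S 0 * S 1 = S 3) (s12 : S 1 * S 2 = S 4) (s02 : S 0 * S 2 = S 5)
    (s04 : S 0 * S 4 = S 6) (s15 : S 1 * S 5 = S 7) (b0 : ∀ i, i.1 < 3 → B (S i) (S i) = 4)
    (b01 : B (S 0) (S 1) = b 0 1) (b12 : B (S 1) (S 2) = b 1 2) (b02 : B (S 0) (S 2) = b 0 2)
    (b04 : B (S 0) (S 4) = b 0 4) (i j : Fin 8) : S i * S j = ∑ m, C i j m • S m := by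
  have row : ∀ (i j k : Fin 8) (x : F), C i j = Pi.single k x → S i * S j = x • S k →
      S i * S j - ∑ m, C i j m • S m = 0 := by
    intro i j k x e e'
    rw [e, sum_single_smul, e', sub_self]
  have expand : ∀ (c : Fin 8 → F) (k : Fin 8),
      ∑ m, c m • (S m * S k - ∑ l, C m k l • S l) =
        (∑ m, c m • S m) * S k - ∑ l, (∑ m, c m * C m k l) • S l := by
    intro c k
    simp only [smul_sub, Finset.sum_sub_distrib, Finset.sum_mul, smul_mul_assoc, Finset.smul_sum,
      smul_smul, Finset.sum_smul]
    rw [Finset.sum_comm (f := fun m l => (c m * C m k l) • S l)]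
  -- `D` and `β` are the deviations of products and form values from the table. Subtracting
  -- `sum_cubic` from the cubic identity in `A` leaves a relation linear in `D`, once the deviations
  -- for the three given pairs vanish.
  refine sub_eq_zero.1 (h.defects_eq_zero h2 (D := fun i j => S i * S j - ∑ m, C i j m • S m)
    (β := fun i j => B (S i) (S j) - b i j) (fun i j => by rw [mul_comm, h.comm])
    (fun i j => by rw [hsymm, h.form_symm]) ?_ ?_
    (fun i hi => row _ _ i 2 (h.idem i hi) (idem i hi))
    (row _ _ _ 1 h.row01 (by rw [s01, one_smul])) (row _ _ _ 1 h.row12 (by rw [s12, one_smul]))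
    (row _ _ _ 1 h.row02 (by rw [s02, one_smul])) (row _ _ _ 1 h.row04 (by rw [s04, one_smul]))
    (row _ _ _ 1 h.row15 (by rw [s15, one_smul]))
    (fun i hi => sub_eq_zero.2 ((b0 i hi).trans (h.form_diag i hi).symm))
    (sub_eq_zero.2 b01) (sub_eq_zero.2 b12) (sub_eq_zero.2 b02) (sub_eq_zero.2 b04) i j)
  · intro i j k hi hij hjk dij djk dik bij bjk bik
    have e := hT (S i) (S j) (S k)
    simp only [expand, ← sub_eq_zero.1 dij, ← sub_eq_zero.1 djk, ← sub_eq_zero.1 dik]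
    rw [CubicIdentity, sub_eq_zero.1 bij, sub_eq_zero.1 bjk, hsymm, sub_eq_zero.1 bik,
      mul_comm (S k) (S i)] at e
    have hsum := h.sum_cubic S hi hij hjk
    rw [← sub_eq_zero.1 dij, ← sub_eq_zero.1 djk, ← sub_eq_zero.1 dik] at hsum
    linear_combination (norm := module) e - hsum + hl i • (S j * S k) + hl j • (S i * S k) +
      hl k • (S i * S j)
  · intro i j k hi dij dik
    simp only [smul_eq_mul, mul_sub, Finset.sum_sub_distrib]
    have c := h.assoc i j k hi
    have e : B (S i * S j) (S k) = B (S j) (S i * S k) := by rw [mul_comm, hB]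
    rw [sub_eq_zero.1 dij, sub_eq_zero.1 dik] at e
    simp only [map_sum, map_smul, LinearMap.sum_apply, LinearMap.smul_apply, smul_eq_mul] at e
    rw [e, c]

theorem CubicIdentity.rotate {B : A → A → F} {l : A → F} {x y z : A}
    (h : CubicIdentity η B l x y z) : CubicIdentity η B l y z x := by
  unfold CubicIdentity at *
  linear_combination (norm := module) h

theorem CubicIdentity.swap {B : A → A → F} (hB : ∀ u v, B u v = B v u) {l : A → F} {x y z : A}
    (h : CubicIdentity η B l x y z) : CubicIdentity η B l x z y := by
  unfold CubicIdentity at *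
  rw [mul_comm x z, mul_comm z y, mul_comm y x, hB x z, hB z y, hB y x]
  linear_combination (norm := module) h

theorem CubicIdentity.of_span {B : LinearMap.BilinForm F A} {l : A →ₗ[F] F} {X : Set A} {y z : A}
    (h : ∀ x ∈ X, CubicIdentity η (fun u v => B u v) l x y z) {x : A}
    (hx : x ∈ Submodule.span F X) : CubicIdentity η (fun u v => B u v) l x y z := by
  induction hx using Submodule.span_induction with
  | mem a ha => exact h a ha
  | zero => simp [CubicIdentity]
  | add u v _ _ hu hv =>
    simp only [CubicIdentity, add_mul, mul_add, map_add, LinearMap.add_apply] at hu hv ⊢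
    linear_combination (norm := module) hu + hv
  | smul r u _ hu =>
    simp only [CubicIdentity, smul_mul_assoc, mul_smul_comm, map_smul, LinearMap.smul_apply,
      smul_eq_mul] at hu ⊢
    linear_combination (norm := module) r • hu

/-- In an algebra with a given table, the halves of the first three basis vectors are axes. -/
theorem IsCubicTable.isPeirceAxis (h2 : (2 : F) ≠ 0) (hη1 : η ≠ 1) (hη2 : η ≠ 1 / 2)
    (h : IsCubicTable η C b w) (s : Module.Basis (Fin 8) F A)
    (hs : ∀ i j, s i * s j = ∑ m, C i j m • s m) (i : Fin 8) (hi : i.1 < 3) {a : A}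
    (ha : (2 : F) • a = s i) : IsPeirceAxis η a := by
  let B : LinearMap.BilinForm F A := s.constr F fun i => s.constr F (b i)
  let l : A →ₗ[F] F := s.constr F w
  have hBs : ∀ i j, B (s i) (s j) = b i j := by
    intro i j
    simp only [B, Module.Basis.constr_basis]
  have hls : ∀ i, l (s i) = w i := fun i => s.constr_basis F w i
  have ha' : a = (2 : F)⁻¹ • s i := by rw [← ha, inv_smul_smul₀ h2]
  have hsymm : ∀ u v, B u v = B v u := by
    have : B = B.flip := s.ext fun i => s.ext fun j => by
      change B (s i) (s j) = B (s j) (s i)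
      rw [hBs, hBs, h.form_symm]
    intro u v
    conv_lhs => rw [this]
    rfl
  -- The table gives the identity for sorted indices; its symmetry in the three arguments removes
  -- the ordering.
  have hsorted : ∀ i j k : Fin 8, i.1 < 3 → i ≤ j → j ≤ k →
      CubicIdentity η (fun u v => B u v) l (s i) (s j) (s k) := by
    intro i j k hi hij hjk
    rw [CubicIdentity, hls, hls, hls, hBs, hBs, hBs, mul_comm (s k) (s i), h.form_symm k i, hs i j,
      hs j k, hs i k, ← h.sum_cubic s hi hij hjk]
    simp only [Finset.sum_mul, smul_mul_assoc, hs, Finset.smul_sum, smul_smul, Finset.sum_smul]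
    congr 1
    congr 1
    all_goals exact Finset.sum_comm
  have hbasis : ∀ i j k : Fin 8, i.1 < 3 →
      CubicIdentity η (fun u v => B u v) l (s i) (s j) (s k) := by
    have aux : ∀ i j k : Fin 8, i.1 < 3 → j ≤ k →
        CubicIdentity η (fun u v => B u v) l (s i) (s j) (s k) := by
      intro i j k hi hjk
      rcases le_total i j with hij | hij
      · exact hsorted i j k hi hij hjk
      · have hj : j.1 < 3 := lt_of_le_of_lt hij hi
        rcases le_total i k with hik | hik
        · exact ((hsorted j i k hj hij hik).swap hsymm).rotate.rotate
        · exact (hsorted j k i hj hjk hik).rotate.rotate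
    intro i j k hi
    rcases le_total j k with hjk | hjk
    · exact aux i j k hi hjk
    · exact (aux i k j hi hjk).swap hsymm
  have hspan : ∀ u : A, u ∈ Submodule.span F (Set.range s) := fun u => s.mem_span u
  have hT : ∀ y z, CubicIdentity η (fun u v => B u v) l a y z := by
    intro y z
    have e : CubicIdentity η (fun u v => B u v) l (s i) y z := by
      -- Each of the two free arguments is rotated to the first place, extended linearly there, and
      -- rotated back.
      refine (CubicIdentity.of_span ?_ (hspan z)).rotate
      rintro _ ⟨k, rfl⟩
      refine CubicIdentity.rotate (CubicIdentity.rotate ?_)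
      refine (CubicIdentity.of_span ?_ (hspan y)).rotate.rotate
      rintro _ ⟨j, rfl⟩
      exact (hbasis i j k hi).rotate
    refine CubicIdentity.of_span (X := {s i}) ?_ ?_
    · rintro _ rfl
      exact e
    · rw [ha']
      exact Submodule.smul_mem _ _ (Submodule.mem_span_singleton_self _)
  have h4 : (2 : F)⁻¹ * ((2 : F)⁻¹ * 4) = 1 := by
    rw [show (4 : F) = 2 * 2 by norm_num, inv_mul_cancel_left₀ h2, inv_mul_cancel₀ h2]
  refine isPeirceAxis_of_cubicIdentity h2 hη1 hη2 ?_ ?_ (B := B) (l := l) ?_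
    (fun u => hsymm u a) ?_ ?_ hT
  · rw [ha', smul_mul_assoc, mul_smul_comm, hs, h.idem i hi, sum_single_smul, inv_smul_smul₀ h2]
  · intro h0
    rw [h0, smul_zero] at ha
    exact s.ne_zero i ha.symm
  · rw [ha', map_smul, map_smul, LinearMap.smul_apply, hBs, h.form_diag i hi]
    exact h4
  · have : B.comp (LinearMap.mulLeft F (s i)) LinearMap.id =
        B.comp LinearMap.id (LinearMap.mulLeft F (s i)) := s.ext fun j => s.ext fun k => by
      change B (s i * s j) (s k) = B (s j) (s i * s k)
      have := h.assoc i j k hi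
      simpa only [hs, map_sum, map_smul, LinearMap.sum_apply, LinearMap.smul_apply, smul_eq_mul,
        hBs] using this
    intro u v
    have e : B (s i * u) v = B u (s i * v) := LinearMap.congr_fun (LinearMap.congr_fun this u) v
    rw [ha', smul_mul_assoc, smul_mul_assoc, map_smul, map_smul, LinearMap.smul_apply, e]
  · intro u
    have : (1 + η) • l = (1 + η) • B a := s.ext fun j => by
      rw [LinearMap.smul_apply, LinearMap.smul_apply, ha', map_smul, LinearMap.smul_apply, hBs, hls]
      have := h.weight i j hi
      simp only [smul_eq_mul]
      field_simp
      linear_combination this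
    exact LinearMap.congr_fun this u

end CubicTableAlgebra

/-! ### The two tables -/

namespace StructureData

section Check

variable (d : StructureData)

/-- The computable conditions for the structure constants to form a table as in
`IsCubicTable`. -/
structure IsValid : Prop where
  cubic : ∀ i j k l : Fin 8, i.1 < 3 → i ≤ j → j ≤ k → (d.cubicDefect i j k l).isZero = true
  assoc : ∀ i j k : Fin 8, i.1 < 3 → j ≤ k → (d.assocDefect i j k).isZero = true
  idem : ∀ i m : Fin 8, i.1 < 3 → (d.coeff i i m - 2 * delta i m).isZero = true
  row01 : ∀ m : Fin 8, (d.coeff 0 1 m - delta 3 m).isZero = true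
  row12 : ∀ m : Fin 8, (d.coeff 1 2 m - delta 4 m).isZero = true
  row02 : ∀ m : Fin 8, (d.coeff 0 2 m - delta 5 m).isZero = true
  row04 : ∀ m : Fin 8, (d.coeff 0 4 m - delta 6 m).isZero = true
  row15 : ∀ m : Fin 8, (d.coeff 1 5 m - delta 7 m).isZero = true
  tail : ∀ m : Fin 8, 6 ≤ m.1 → ((d.coeff 0 3 m).isZero && (d.coeff 1 3 m).isZero &&
    (d.coeff 1 4 m).isZero && (d.coeff 2 4 m).isZero && (d.coeff 0 5 m).isZero &&
    (d.coeff 2 5 m).isZero && (d.coeff 2 3 m + 1).isZero && (d.coeff 0 7 m - 1).isZero) = true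
  form_diag : ∀ i : Fin 8, i.1 < 3 → (d.formCoeff i i - 4).isZero = true
  weight : ∀ i j : Fin 8, i.1 < 3 →
    ((1 + d.eta) * (2 * d.weightCoeff j) - (1 + d.eta) * d.formCoeff i j).isZero = true

variable {d} {F : Type*} [Field F] (v : F × F × F × F)

theorem eval_delta (k l : Fin 8) : (delta k l).eval v = if k = l then 1 else 0 := by
  rw [delta]
  split_ifs
  exacts [IntPoly.eval_one v, IntPoly.eval_zero v]

theorem coeff_comm (i j m : Fin 8) : d.coeff i j m = d.coeff j i m := by
  rw [coeff, coeff, min_comm, max_comm]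

theorem formCoeff_comm (i j : Fin 8) : d.formCoeff i j = d.formCoeff j i := by
  rw [formCoeff, formCoeff, min_comm, max_comm]

theorem row_of_isZero {i j k : Fin 8} {x : F} {y : IntPoly} (hx : y.eval v = x)
    (h : ∀ m, (d.coeff i j m - y * delta k m).isZero = true) :
    (fun m => (d.coeff i j m).eval v) = Pi.single k x := by
  ext m
  have := IntPoly.eval_eq_zero v (h m)
  rw [IntPoly.eval_sub, IntPoly.eval_mul, eval_delta, hx, sub_eq_zero] at this
  rw [this, Pi.single_apply]
  simp [eq_comm]

theorem row_of_isZero' {i j k : Fin 8} (h : ∀ m, (d.coeff i j m - delta k m).isZero = true) :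
    (fun m => (d.coeff i j m).eval v) = Pi.single k 1 := by
  ext m
  have := IntPoly.eval_eq_zero v (h m)
  rw [IntPoly.eval_sub, eval_delta, sub_eq_zero] at this
  rw [this, Pi.single_apply]
  simp [eq_comm]

theorem IsValid.isCubicTable (h : d.IsValid) :
    IsCubicTable (d.eta.eval v) (fun i j m => (d.coeff i j m).eval v)
      (fun i j => (d.formCoeff i j).eval v) (fun i => (d.weightCoeff i).eval v) := by
  have tail := fun m hm => h.tail m hm
  simp only [Bool.and_eq_true] at tail
  have tail' : ∀ m : Fin 8, 6 ≤ m.1 → (d.coeff 0 3 m).eval v = 0 ∧ (d.coeff 1 3 m).eval v = 0 ∧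
      (d.coeff 1 4 m).eval v = 0 ∧ (d.coeff 2 4 m).eval v = 0 ∧ (d.coeff 0 5 m).eval v = 0 ∧
      (d.coeff 2 5 m).eval v = 0 ∧ (d.coeff 2 3 m).eval v = -1 ∧ (d.coeff 0 7 m).eval v = 1 := by
    intro m hm
    obtain ⟨⟨⟨⟨⟨⟨⟨h1, h2⟩, h3⟩, h4⟩, h5⟩, h6⟩, h7⟩, h8⟩ := tail m hm
    have h7' := IntPoly.eval_eq_zero v h7
    have h8' := IntPoly.eval_eq_zero v h8
    rw [IntPoly.eval_add, IntPoly.eval_one] at h7'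
    rw [IntPoly.eval_sub, IntPoly.eval_one] at h8'
    exact ⟨IntPoly.eval_eq_zero v h1, IntPoly.eval_eq_zero v h2, IntPoly.eval_eq_zero v h3,
      IntPoly.eval_eq_zero v h4, IntPoly.eval_eq_zero v h5, IntPoly.eval_eq_zero v h6,
      eq_neg_of_add_eq_zero_left h7', sub_eq_zero.1 h8'⟩
  obtain ⟨p1, p2, p3, p4, p5, p6, p7, p8⟩ := tail' 6 (by decide)
  obtain ⟨q1, q2, q3, q4, q5, q6, q7, q8⟩ := tail' 7 (by decide)
  have assoc : ∀ i j k : Fin 8, i.1 < 3 → j ≤ k →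
      ∑ m, (d.coeff i j m).eval v * (d.formCoeff m k).eval v =
        ∑ m, (d.coeff i k m).eval v * (d.formCoeff j m).eval v := by
    intro i j k hi hjk
    have := IntPoly.eval_eq_zero v (h.assoc i j k hi hjk)
    simp only [assocDefect, indices, List.foldr, IntPoly.eval_add, IntPoly.eval_sub,
      IntPoly.eval_mul, IntPoly.eval_zero] at this
    rw [Fin.sum_univ_eight, Fin.sum_univ_eight]
    linear_combination this
  refine ⟨fun i j => funext fun m => by rw [coeff_comm], fun i j => by rw [formCoeff_comm], ?_, ?_,
    fun i hi => row_of_isZero v (IntPoly.eval_ofNat v 2) fun m => h.idem i m hi,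
    row_of_isZero' v h.row01, row_of_isZero' v h.row12, row_of_isZero' v h.row02,
    row_of_isZero' v h.row04, row_of_isZero' v h.row15, ⟨p1, q1⟩, ⟨p2, q2⟩, ⟨p3, q3⟩, ⟨p4, q4⟩,
    ⟨p5, q5⟩, ⟨p6, q6⟩, ⟨p7, q7⟩, ⟨p8, q8⟩, fun i hi => ?_, fun i j hi => ?_⟩
  · intro i j k l hi hij hjk
    have := IntPoly.eval_eq_zero v (h.cubic i j k l hi hij hjk)
    simp only [cubicDefect, indices, List.foldr, IntPoly.eval_add, IntPoly.eval_sub,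
      IntPoly.eval_mul, IntPoly.eval_zero, IntPoly.eval_one, eval_delta] at this
    rw [Fin.sum_univ_eight]
    linear_combination this
  · intro i j k hi
    rcases le_total j k with hjk | hjk
    · exact assoc i j k hi hjk
    · have := assoc i k j hi hjk
      simp only [formCoeff_comm k, formCoeff_comm _ j] at this ⊢
      exact this.symm
  · have := IntPoly.eval_eq_zero v (h.form_diag i hi)
    rw [IntPoly.eval_sub, IntPoly.eval_ofNat] at this
    exact sub_eq_zero.1 this
  · have := IntPoly.eval_eq_zero v (h.weight i j hi)
    simp only [IntPoly.eval_add, IntPoly.eval_sub, IntPoly.eval_mul, IntPoly.eval_one,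
      IntPoly.eval_ofNat] at this
    exact sub_eq_zero.1 this

theorem negOne_isValid : negOne.IsValid :=
  ⟨negOne_cubicDefect, negOne_assocDefect, by decide +kernel, by decide +kernel, by decide +kernel,
    by decide +kernel, by decide +kernel, by decide +kernel, by decide +kernel, by decide +kernel,
    by decide +kernel⟩

theorem generic_isValid : generic.IsValid :=
  ⟨generic_cubicDefect, generic_assocDefect, by decide +kernel, by decide +kernel,
    by decide +kernel, by decide +kernel, by decide +kernel, by decide +kernel, by decide +kernel,
    by decide +kernel, by decide +kernel⟩

end Check

section Scaled

/-- The factors by which `a, b, c, ab, bc, ac, a(bc), b(ac)` are multiplied. -/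
def scale (F : Type*) [Field F] : Fin 8 → F := ![2, 2, 2, 4, 4, 4, 8, 8]

variable {F M : Type*} [Field F] [AddCommGroup M] [Module F M]

theorem half_smul_lemmas (h2 : (2 : F) ≠ 0) (x : M) :
    (8 : F) • (1 / 2 : F) • x = (4 : F) • x ∧ (16 : F) • (1 / 2 : F) • x = (8 : F) • x ∧
    (16 : F) • (1 / 4 : F) • x = (4 : F) • x ∧ (32 : F) • (1 / 8 : F) • x = (4 : F) • x ∧
    (64 : F) • (1 / 16 : F) • x = (4 : F) • x := by
  have h4 : (4 : F) = 2 * 2 := by norm_num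
  have h8 : (8 : F) = 2 * 2 * 2 := by norm_num
  have h16 : (16 : F) = 2 * 2 * 2 * 2 := by norm_num
  have h32 : (32 : F) = 2 * 2 * 2 * 2 * 2 := by norm_num
  have h64 : (64 : F) = 2 * 2 * 2 * 2 * 2 * 2 := by norm_num
  simp only [smul_smul, h4, h8, h16, h32, h64]
  refine ⟨?_, ?_, ?_, ?_, ?_⟩ <;> · congr 1; field_simp

theorem scale_mul (F : Type*) [Field F] : (2 * 2 : F) = 4 ∧ (2 * 4 : F) = 8 ∧ (2 * 8 : F) = 16 ∧
    (4 * 4 : F) = 16 ∧ (4 * 8 : F) = 32 ∧ (8 * 8 : F) = 64 := by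
  norm_num

-- Links the computed integer data with the original table: the factors `2, 4, 8` absorb all
-- denominators. The analogue for `η ≠ -1` follows.
set_option maxHeartbeats 2000000 in
theorem negOne_scaled (h2 : (2 : F) ≠ 0) (α β γ ψ : F) (e : Fin 8 → M) (i j : Fin 8)
    (hij : i ≤ j) :
    (scale F i * scale F j) •
      upperTableNegOne α β γ ψ (e 0) (e 1) (e 2) (e 3) (e 4) (e 5) (e 6) (e 7) i j =
    ∑ m, (negOne.coeff i j m).eval (α, β, γ, ψ) • scale F m • e m := by
  obtain ⟨n1, n2, n3, n4, n5, n6⟩ := scale_mul F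
  have k := half_smul_lemmas (M := M) h2
  have k1 := fun x => (k x).1
  have k2 := fun x => (k x).2.1
  have k3 := fun x => (k x).2.2.1
  have k4 := fun x => (k x).2.2.2.1
  have k5 := fun x => (k x).2.2.2.2
  rw [Fin.sum_univ_eight]
  fin_cases i <;> fin_cases j <;> first | exact absurd hij (by decide) | skip
  all_goals
    simp [upperTableNegOne, scale, negOne, coeff, entry, n1, n2, n3, n4, n5, n6, -one_div,
      IntPoly.eval_add, IntPoly.eval_sub, IntPoly.eval_mul, IntPoly.eval_neg, IntPoly.eval_one,
      IntPoly.eval_zero, IntPoly.eval_ofNat, IntPoly.eval_x₁, IntPoly.eval_x₂,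
      IntPoly.eval_x₃, IntPoly.eval_x₄]
  all_goals
    try simp only [smul_add, smul_sub, k1, k2, k3, k4, k5]
    module

set_option maxHeartbeats 2000000 in
theorem generic_scaled (h2 : (2 : F) ≠ 0) (η : F) (e : Fin 8 → M) (i j : Fin 8)
    (hij : i ≤ j) :
    (scale F i * scale F j) •
      upperTableGeneric η (e 0) (e 1) (e 2) (e 3) (e 4) (e 5) (e 6) (e 7) i j =
    ∑ m, (generic.coeff i j m).eval (η, 0, 0, 0) • scale F m • e m := by
  obtain ⟨n1, n2, n3, n4, n5, n6⟩ := scale_mul F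
  have k := half_smul_lemmas (M := M) h2
  have k1 := fun x => (k x).1
  have k2 := fun x => (k x).2.1
  have k3 := fun x => (k x).2.2.1
  have k4 := fun x => (k x).2.2.2.1
  have k5 := fun x => (k x).2.2.2.2
  rw [Fin.sum_univ_eight]
  fin_cases i <;> fin_cases j <;> first | exact absurd hij (by decide) | skip
  all_goals
    simp [upperTableGeneric, scale, generic, coeff, entry, n1, n2, n3, n4, n5, n6, -one_div,
      IntPoly.eval_add, IntPoly.eval_sub, IntPoly.eval_mul, IntPoly.eval_neg, IntPoly.eval_one,
      IntPoly.eval_zero, IntPoly.eval_ofNat, IntPoly.eval_x₁]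
  all_goals
    try simp only [smul_add, smul_sub, k1, k2, k3, k4, k5]
    module

end Scaled
end StructureData

/-! ### The algebra `A(α, β, γ, ψ)` in the scaled basis -/

section PCTable

variable {F : Type*} [Field F]

open Classical in
/-- The scaled structure constants of `A(α, β, γ, ψ)`. -/
noncomputable def pcData (η : F) : StructureData :=
  if η = -1 then StructureData.negOne else StructureData.generic

open Classical in
/-- The point at which the structure constants are evaluated. -/
noncomputable def pcPoint (η α β γ ψ : F) : F × F × F × F :=
  if η = -1 then (α, β, γ, ψ) else (η, 0, 0, 0)

noncomputable def pcCoeff (η α β γ ψ : F) (i j m : Fin 8) : F :=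
  ((pcData η).coeff i j m).eval (pcPoint η α β γ ψ)

noncomputable def pcForm (η α β γ ψ : F) (i j : Fin 8) : F :=
  ((pcData η).formCoeff i j).eval (pcPoint η α β γ ψ)

noncomputable def pcWeight (η α β γ ψ : F) (i : Fin 8) : F :=
  ((pcData η).weightCoeff i).eval (pcPoint η α β γ ψ)

open StructureData

theorem pc_isCubicTable (η α β γ ψ : F) :
    IsCubicTable η (pcCoeff η α β γ ψ) (pcForm η α β γ ψ) (pcWeight η α β γ ψ) := by
  have hη : (pcData η).eta.eval (pcPoint η α β γ ψ) = η := by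
    unfold pcData pcPoint
    split_ifs with h
    · rw [h]
      exact (IntPoly.eval_neg _ 1).trans (by rw [IntPoly.eval_one])
    · exact IntPoly.eval_x₁ _
  have hv : (pcData η).IsValid := by
    unfold pcData
    split_ifs
    exacts [negOne_isValid, generic_isValid]
  have := hv.isCubicTable (pcPoint η α β γ ψ)
  rwa [hη] at this

theorem scale_ne_zero (h2 : (2 : F) ≠ 0) (i : Fin 8) : scale F i ≠ 0 := by
  have h4 : (4 : F) ≠ 0 := by
    rw [← (scale_mul F).1]
    exact mul_ne_zero h2 h2
  have h8 : (8 : F) ≠ 0 := by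
    rw [← (scale_mul F).2.1]
    exact mul_ne_zero h2 h4
  fin_cases i
  exacts [h2, h2, h2, h4, h4, h4, h8, h8]

theorem pcWeight_eq {η : F} (hη : η ≠ -1) (α β γ ψ : F) (i : Fin 8) :
    pcWeight η α β γ ψ i = scale F i := by
  rw [pcWeight, pcData, if_neg hη]
  fin_cases i
  exacts [IntPoly.eval_ofNat _ 2, IntPoly.eval_ofNat _ 2, IntPoly.eval_ofNat _ 2,
    IntPoly.eval_ofNat _ 4, IntPoly.eval_ofNat _ 4, IntPoly.eval_ofNat _ 4,
    IntPoly.eval_ofNat _ 8, IntPoly.eval_ofNat _ 8]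

theorem pcForm_values {η α β γ ψ : F} (hpar : η ≠ -1 → α = 1 ∧ β = 1 ∧ γ = 1 ∧ ψ = 1) :
    pcForm η α β γ ψ 0 1 = 4 * α ∧ pcForm η α β γ ψ 1 2 = 4 * β ∧
    pcForm η α β γ ψ 0 2 = 4 * γ ∧ pcForm η α β γ ψ 0 4 = 8 * ψ := by
  unfold pcForm pcData pcPoint
  split_ifs with h
  · have key : ∀ (n : IntPoly) (k : F) (x : IntPoly) (t : F), n.eval (α, β, γ, ψ) = k →
        x.eval (α, β, γ, ψ) = t → (n * x).eval (α, β, γ, ψ) = k * t := by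
      intro n k x t hn hx
      rw [IntPoly.eval_mul, hn, hx]
    exact ⟨key 4 4 _ _ (IntPoly.eval_ofNat _ 4) (IntPoly.eval_x₁ _),
      key 4 4 _ _ (IntPoly.eval_ofNat _ 4) (IntPoly.eval_x₂ _),
      key 4 4 _ _ (IntPoly.eval_ofNat _ 4) (IntPoly.eval_x₃ _),
      key 8 8 _ _ (IntPoly.eval_ofNat _ 8) (IntPoly.eval_x₄ _)⟩
  · obtain ⟨rfl, rfl, rfl, rfl⟩ := hpar h
    simp only [mul_one]
    exact ⟨IntPoly.eval_ofNat _ 4, IntPoly.eval_ofNat _ 4, IntPoly.eval_ofNat _ 4,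
      IntPoly.eval_ofNat _ 8⟩

namespace PCAlgebra

variable {η α β γ ψ : F}

variable (η α β γ ψ) in
/-- The standard basis. -/
noncomputable def stdBasis : Module.Basis (Fin 8) F (PCAlgebra η α β γ ψ) :=
  Module.Basis.ofEquivFun
    { toFun := coord
      invFun := fun u => u
      map_add' := fun _ _ => rfl
      map_smul' := fun _ _ => rfl
      left_inv := fun _ => rfl
      right_inv := fun _ => rfl }

theorem stdBasis_apply (i : Fin 8) : stdBasis η α β γ ψ i = basisVec η α β γ ψ i := by
  apply (stdBasis η α β γ ψ).equivFun.injective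
  refine funext fun j => ?_
  rw [Module.Basis.equivFun_self]
  change (if i = j then (1 : F) else 0) = (Pi.single i 1 : Fin 8 → F) j
  rw [Pi.single_apply]
  simp [eq_comm]

theorem basisVec_mul_basisVec (i j : Fin 8) :
    basisVec η α β γ ψ i * basisVec η α β γ ψ j = table η α β γ ψ i j := by
  rw [mul_def, Finset.sum_eq_single i, Finset.sum_eq_single j]
  · simp [coord, basisVec]
  · intro k _ hk
    simp [coord, basisVec, hk]
  · simp
  · intro k _ hk
    simp [coord, basisVec, hk]
  · simp

variable (η α β γ ψ) in
/-- The basis `2a, 2b, 2c, 4ab, 4bc, 4ac, 8a(bc), 8b(ac)`. -/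
noncomputable def scaledBasis (h2 : (2 : F) ≠ 0) :
    Module.Basis (Fin 8) F (PCAlgebra η α β γ ψ) :=
  (stdBasis η α β γ ψ).unitsSMul fun i => Units.mk0 (scale F i) (scale_ne_zero h2 i)

theorem scaledBasis_apply (h2 : (2 : F) ≠ 0) (i : Fin 8) :
    scaledBasis η α β γ ψ h2 i = scale F i • basisVec η α β γ ψ i := by
  rw [scaledBasis, Module.Basis.unitsSMul_apply, stdBasis_apply]
  rfl

theorem scaledBasis_mul (h2 : (2 : F) ≠ 0) (i j : Fin 8) :
    scaledBasis η α β γ ψ h2 i * scaledBasis η α β γ ψ h2 j =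
      ∑ m, pcCoeff η α β γ ψ i j m • scaledBasis η α β γ ψ h2 m := by
  have key : ∀ i j : Fin 8, i ≤ j → scaledBasis η α β γ ψ h2 i * scaledBasis η α β γ ψ h2 j =
      ∑ m, pcCoeff η α β γ ψ i j m • scaledBasis η α β γ ψ h2 m := by
    intro i j hij
    simp only [scaledBasis_apply]
    rw [smul_mul_smul_comm, basisVec_mul_basisVec, table, min_eq_left hij, max_eq_right hij,
      upperTable]
    unfold pcCoeff pcData pcPoint
    split_ifs with h
    · exact negOne_scaled h2 α β γ ψ (basisVec η α β γ ψ) i j hij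
    · exact generic_scaled h2 η (basisVec η α β γ ψ) i j hij
  rcases le_total i j with hij | hij
  · exact key i j hij
  · rw [mul_comm, key j i hij, (pc_isCubicTable η α β γ ψ).comm i j]

/-- `A(α, β, γ, ψ)` is generated by the primitive axes `a`, `b`, `c`. -/
theorem isPrimitiveAxialAlgebra (h2 : (2 : F) ≠ 0) (hη1 : η ≠ 1) (hη2 : η ≠ 1 / 2) :
    IsPrimitiveAxialAlgebra (pcLaw η)
      {basisVec η α β γ ψ 0, basisVec η α β γ ψ 1, basisVec η α β γ ψ 2} := by
  have hC := pc_isCubicTable η α β γ ψ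
  set s := scaledBasis η α β γ ψ h2 with hs
  have hax : ∀ i : Fin 8, i.1 < 3 → scale F i = 2 →
      IsPrimitiveAxis (pcLaw η) (basisVec η α β γ ψ i) := by
    intro i hi hsi
    refine (hC.isPeirceAxis h2 hη1 hη2 s (scaledBasis_mul h2) i hi ?_).isPrimitiveAxis h2 hη1 hη2
    rw [hs, scaledBasis_apply, hsi]
  constructor
  · rintro a (rfl | rfl | rfl)
    exacts [hax 0 (by decide) rfl, hax 1 (by decide) rfl, hax 2 (by decide) rfl]
  · set X : Set (PCAlgebra η α β γ ψ) :=
      {basisVec η α β γ ψ 0, basisVec η α β γ ψ 1, basisVec η α β γ ψ 2} with hX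
    set N := NonUnitalAlgebra.adjoin F X with hN
    have hsub : X ⊆ N := NonUnitalAlgebra.subset_adjoin F
    have m0 : s 0 ∈ N := by
      rw [hs, scaledBasis_apply]
      exact SMulMemClass.smul_mem _ (hsub (Or.inl rfl))
    have m1 : s 1 ∈ N := by
      rw [hs, scaledBasis_apply]
      exact SMulMemClass.smul_mem _ (hsub (Or.inr (Or.inl rfl)))
    have m2 : s 2 ∈ N := by
      rw [hs, scaledBasis_apply]
      exact SMulMemClass.smul_mem _ (hsub (Or.inr (Or.inr rfl)))
    have hprod : ∀ i j k : Fin 8, pcCoeff η α β γ ψ i j = Pi.single k 1 → s i ∈ N → s j ∈ N →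
        s k ∈ N := by
      intro i j k e hi hj
      have := N.mul_mem hi hj
      rwa [hs, scaledBasis_mul, e, sum_single_smul, one_smul] at this
    have m3 := hprod 0 1 3 hC.row01 m0 m1
    have m4 := hprod 1 2 4 hC.row12 m1 m2
    have m5 := hprod 0 2 5 hC.row02 m0 m2
    have m6 := hprod 0 4 6 hC.row04 m0 m4
    have m7 := hprod 1 5 7 hC.row15 m1 m5
    have hall : ∀ i, s i ∈ N := by
      intro i
      fin_cases i
      exacts [m0, m1, m2, m3, m4, m5, m6, m7]
    refine NonUnitalAlgebra.eq_top_iff.2 fun u => ?_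
    have hle : Submodule.span F (Set.range s) ≤ N.toSubmodule :=
      Submodule.span_le.2 (by rintro _ ⟨i, rfl⟩; exact hall i)
    exact hle (s.mem_span u)

end PCAlgebra

end PCTable

/-! ### Homomorphisms onto algebras generated by three axes -/

section Image

variable {F A : Type*} [Field F] [NonUnitalNonAssocCommRing A] [Module F A]
  [IsScalarTower F A A] [SMulCommClass F A A] {η : F}

open StructureData

/-- An algebra generated by three primitive axes is an image of `A(α, β, γ, ψ)`. -/
theorem exists_surjective_of_form (h2 : (2 : F) ≠ 0) (hη1 : η ≠ 1) (hη2 : η ≠ 1 / 2)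
    {α β γ ψ : F} (hpar : η ≠ -1 → α = 1 ∧ β = 1 ∧ γ = 1 ∧ ψ = 1) {x y z : A}
    (hx : IsPeirceAxis η x) (hy : IsPeirceAxis η y) (hz : IsPeirceAxis η z)
    (hgen : NonUnitalAlgebra.adjoin F ({x, y, z} : Set A) = ⊤)
    (hspan : Submodule.span F {a : A | IsPeirceAxis η a} = ⊤)
    {B : LinearMap.BilinForm F A} (hsymm : ∀ u v, B u v = B v u)
    (hB : ∀ u v w, B (u * v) w = B u (v * w)) (hB1 : ∀ a, IsPeirceAxis η a → B a a = 1)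
    (hw : η ≠ -1 → ∀ a b, IsPeirceAxis η a → IsPeirceAxis η b → B a b = 1)
    (hα : B x y = α) (hβ : B y z = β) (hγ : B x z = γ) (hψ : B x (y * z) = ψ) :
    ∃ f : PCAlgebra η α β γ ψ →ₙₐ[F] A, Function.Surjective f := by
  have hC := pc_isCubicTable η α β γ ψ
  let E : Fin 8 → A := ![x, y, z, x * y, y * z, x * z, x * (y * z), y * (x * z)]
  let S : Fin 8 → A := fun i => scale F i • E i
  obtain ⟨n1, n2, n3, -⟩ := scale_mul F
  have hSS : ∀ i j k : Fin 8, scale F i * scale F j = scale F k → E i * E j = E k →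
      S i * S j = S k := by
    intro i j k e e'
    simp only [S]
    rw [smul_mul_smul_comm, e, e']
  have hBS : ∀ i j, B (S i) (S j) = scale F i * scale F j * B (E i) (E j) := by
    intro i j
    simp only [S, map_smul, LinearMap.smul_apply, smul_eq_mul]
    ring
  have hE1 : ∀ i : Fin 8, i.1 < 3 → IsPeirceAxis η (E i) ∧ scale F i = 2 := by
    intro i hi
    have : i = 0 ∨ i = 1 ∨ i = 2 := by omega
    rcases this with rfl | rfl | rfl
    exacts [⟨hx, rfl⟩, ⟨hy, rfl⟩, ⟨hz, rfl⟩]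
  -- For `η = -1` both sides vanish. Otherwise `x` and `y` have the same row, so multiplication by
  -- either of these idempotents does not change `B x`, and every `E i` has weight `1`.
  have hl : ∀ i, (1 + η) * B x (S i) = (1 + η) * pcWeight η α β γ ψ i := by
    intro i
    by_cases hη : η = -1
    · rw [hη]
      ring
    · have hyx : ∀ u, B y u = B x u := by
        refine LinearMap.congr_fun (LinearMap.ext_on hspan fun b hb => ?_)
        rw [hw hη y b hy hb, hw hη x b hx hb]
      have hE : B x (E i) = 1 := by
        have k1 : ∀ u, B x (x * u) = B x u := fun u => by rw [← hB, hx.idem]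
        have k2 : ∀ u, B x (y * u) = B x u := fun u => by rw [← hyx, ← hB, hy.idem, hyx]
        have xx := hB1 x hx
        have xy := hw hη x y hx hy
        have xz := hw hη x z hx hz
        fin_cases i
        · exact xx
        · exact xy
        · exact xz
        · exact (k1 _).trans xy
        · exact (k2 _).trans xz
        · exact (k1 _).trans xz
        · exact (k1 _).trans ((k2 _).trans xz)
        · exact (k2 _).trans ((k1 _).trans xz)
      rw [pcWeight_eq hη]
      simp only [S, map_smul, hE, smul_eq_mul, mul_one]
  obtain ⟨f1, f2, f3, f4⟩ := pcForm_values hpar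
  have hmul := hC.mul_eq h2 hsymm hB
    (cubicIdentity_of_span_axes h2 hη1 hη2 hspan hsymm hB hB1 hx hw) hl
    (fun i hi => by
      obtain ⟨h1, h3⟩ := hE1 i hi
      simp only [S, h3]
      rw [smul_mul_smul_comm, h1.idem, mul_smul])
    (hSS 0 1 3 n1 rfl) (hSS 1 2 4 n1 rfl) (hSS 0 2 5 n1 rfl) (hSS 0 4 6 n2 rfl) (hSS 1 5 7 n2 rfl)
    (fun i hi => by
      obtain ⟨h1, h3⟩ := hE1 i hi
      rw [hBS, h3, n1, hB1 _ h1, mul_one])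
    (by rw [hBS, f1, ← hα, ← n1]; rfl) (by rw [hBS, f2, ← hβ, ← n1]; rfl)
    (by rw [hBS, f3, ← hγ, ← n1]; rfl) (by rw [hBS, f4, ← hψ, ← n2]; rfl)
  let s := PCAlgebra.scaledBasis η α β γ ψ h2
  let g : PCAlgebra η α β γ ψ →ₗ[F] A := s.constr F S
  have hg : ∀ i, g (s i) = S i := fun i => s.constr_basis F S i
  have hgmul : ∀ u v, g (u * v) = g u * g v := by
    have : (LinearMap.mul F (PCAlgebra η α β γ ψ)).compr₂ g = (LinearMap.mul F A).compl₁₂ g g := by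
      refine s.ext fun i => s.ext fun j => ?_
      change g (s i * s j) = g (s i) * g (s j)
      rw [hg, hg, hmul, PCAlgebra.scaledBasis_mul, map_sum]
      exact Finset.sum_congr rfl fun m _ => by rw [map_smul, hg]
    intro u v
    exact LinearMap.congr_fun (LinearMap.congr_fun this u) v
  let f : PCAlgebra η α β γ ψ →ₙₐ[F] A :=
    { toFun := g
      map_smul' := g.map_smul
      map_zero' := g.map_zero
      map_add' := g.map_add
      map_mul' := hgmul }
  refine ⟨f, fun u => ?_⟩
  have hrange : ∀ i : Fin 8, E i ∈ NonUnitalAlgHom.range f := by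
    intro i
    refine ⟨(scale F i)⁻¹ • s i, ?_⟩
    change g _ = _
    rw [map_smul, hg]
    exact inv_smul_smul₀ (scale_ne_zero h2 i) _
  have hle : NonUnitalAlgebra.adjoin F ({x, y, z} : Set A) ≤ NonUnitalAlgHom.range f := by
    refine NonUnitalAlgebra.adjoin_le ?_
    rintro a (rfl | rfl | rfl)
    exacts [hrange 0, hrange 1, hrange 2]
  rw [hgen] at hle
  exact hle (by trivial : u ∈ (⊤ : NonUnitalSubalgebra F A))

end Image

theorem mainTheorem4 {F : Type*} [Field F] (hF2 : ringChar F ≠ 2) (hF3 : ringChar F ≠ 3)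
    (η : F) (hη1 : η ≠ 1) (hη2 : η ≠ 1 / 2) (α β γ ψ : F)
    (hpar : η ≠ -1 → α = 1 ∧ β = 1 ∧ γ = 1 ∧ ψ = 1) :
    -- `A(α, β, γ, ψ)` is a `PC(η)`-axial algebra generated by the primitive axes `e₁, e₂, e₃`
    IsPrimitiveAxialAlgebra (pcLaw η)
      {PCAlgebra.basisVec η α β γ ψ 0, PCAlgebra.basisVec η α β γ ψ 1,
        PCAlgebra.basisVec η α β γ ψ 2} ∧
    -- every `PC(η)`-axial algebra generated by three primitive axes has a unique normalized
    -- Frobenius form; with the given values of it, the algebra is an image of `A(α, β, γ, ψ)`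
    ∀ (A : Type*) [NonUnitalNonAssocCommRing A] [Module F A] [IsScalarTower F A A]
      [SMulCommClass F A A] (x y z : A),
      IsPrimitiveAxialAlgebra (pcLaw η) ({x, y, z} : Set A) →
      (∃! B : LinearMap.BilinForm F A, IsNormalizedFrobeniusForm (pcLaw η) B) ∧
      ∀ B : LinearMap.BilinForm F A, IsNormalizedFrobeniusForm (pcLaw η) B →
        B x y = α → B y z = β → B x z = γ → B x (y * z) = ψ →
        ∃ f : PCAlgebra η α β γ ψ →ₙₐ[F] A, Function.Surjective f := by
  have h2 : (2 : F) ≠ 0 := Ring.two_ne_zero hF2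
  refine ⟨PCAlgebra.isPrimitiveAxialAlgebra h2 hη1 hη2, ?_⟩
  intro A _ _ _ _ x y z hA
  have h12 : (1 / 2 : F) ≠ 1 := by
    intro e
    rw [div_eq_iff h2] at e
    have : (2 : F) - 1 = 0 := by linear_combination -e
    norm_num at this
  have hax : ∀ a : A, IsPeirceAxis η a ↔ IsPrimitiveAxis (pcLaw η) a := fun a =>
    ⟨fun h => h.isPrimitiveAxis h2 hη1 hη2, fun h => h.isPeirceAxis h2 hη1 hη2⟩
  have hX : ∀ a ∈ ({x, y, z} : Set A), IsPeirceAxis η a := fun a ha => (hax a).2 (hA.axis a ha)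
  have hx := hX x (Or.inl rfl)
  have hspan := span_isPeirceAxis_eq_top h2 hη1 hη2 hX hA.generates
  obtain ⟨B, hsymm, hB, hB1, hw⟩ := exists_frobenius_form h2 hη1 hη2 hspan
  have huniq : ∀ C : LinearMap.BilinForm F A, IsNormalizedFrobeniusForm (pcLaw η) C → C = B :=
    fun C hC => frobenius_form_unique hη1 h12 hspan hC.assoc hB
      (fun a ha => hC.normalized a ((hax a).1 ha)) hB1
  refine ⟨⟨B, ⟨?_, hsymm, hB, fun a ha => hB1 a ((hax a).2 ha)⟩, huniq⟩, ?_⟩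
  · rintro rfl
    have := hB1 x hx
    simp at this
  · intro C hC
    -- By uniqueness the given form is the constructed one, for which `(a, b) = 1` on axes is known
    -- when `η ≠ -1`.
    rw [huniq C hC]
    exact exists_surjective_of_form h2 hη1 hη2 hpar hx (hX y (Or.inr (Or.inl rfl)))
      (hX z (Or.inr (Or.inr rfl))) hA.generates hspan hsymm hB hB1 hw
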